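/- For a real matrix $M$ with $k$ columns, call $M$ a minimal linear dependency if there is $x\in\mathbb R^k$ with $Mx=0$ and all $k$ coordinates of $x$ nonzero, and $\operatorname{rank}(M)=k-1$. Let $\mathcal T_k$ (tree dependencies) be the set of $\{0,1\}$-matrices with $k$ columns and exactly $2k-2$ ones whose nonzero rows form the edge-vertex incidence matrix of a tree on $k$ vertices (rows indexed by edges, columns by vertices). For a matrix $M$ and a set $S$ of its columns, $M_S$ is the submatrix of $M$ formed by the columns in $S$ (and all rows). Let $p=p(n)\in[0,1]$ satisfy $np\to\infty$ as $n\to\infty$ and $p\le 1/2$, and let $B\sim\mathbb B(n,p)$, that is, $B$ is an $n\times n$ random matrix with independent entries, each equal to $1$ with probability $p$ and to $0$ otherwise. Then, with probability tending to $1$ as $n\to\infty$, at least one of the following holds: 1. for all $k$ and all sets $S$ of $k$ columns of $B$, if $B_S$ is a minimal linear dependency then $B_S\in\mathcal T_k$; 2. for all $k$ and all sets $S$ of $k$ columns of $B^\top$, if $(B^\top)_S$ is a minimal linear dependency then $(B^\top)_S\in\mathcal T_k$. -/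

import Mathlib

open MeasureTheory ProbabilityTheory Filter Topology

namespace SparseRank

noncomputable section

/-- The law `𝔹(n, p)` of the `n²` independent Bernoulli(`p`) entries of a random matrix,
an entry `true` (value `1`) having probability `p`. -/
def bernoulliLaw (n : ℕ) (p : unitInterval) : Measure (Fin n × Fin n → Bool) :=
  Measure.pi fun _ => bernoulliMeasure true false p

/-- The real `{0,1}`-matrix with the given pattern of ones. -/
def zeroOneMatrix {n : ℕ} (b : Fin n × Fin n → Bool) : Matrix (Fin n) (Fin n) ℝ :=
  Matrix.of fun i j => if b (i, j) = true then 1 else 0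

/-- The submatrix of `M` formed by all rows and by the columns indexed by `S`. -/
def columns {ι κ : Type*} (M : Matrix ι κ ℝ) (S : Finset κ) : Matrix ι S ℝ :=
  M.submatrix id (fun j : S => (j : κ))

/-- A matrix with `k` columns is a minimal linear dependency if its kernel has a vector all of
whose `k` coordinates are nonzero, and its rank is `k - 1`. -/
def IsMinimalDependency {ι κ : Type*} [Fintype κ] (k : ℕ) (M : Matrix ι κ ℝ) : Prop :=
  Fintype.card κ = k ∧ (∃ x : κ → ℝ, M.mulVec x = 0 ∧ ∀ j, x j ≠ 0) ∧ M.rank + 1 = k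

/-- The class `𝒯ₖ` of tree dependencies: `{0,1}`-matrices with `k` columns and exactly `2k - 2`
ones whose nonzero rows form the edge-vertex incidence matrix (rows are edges, columns are
vertices) of a tree on the `k` columns. -/
def IsTreeDependency {ι κ : Type*} [Fintype κ] (k : ℕ) (M : Matrix ι κ ℝ) : Prop :=
  Fintype.card κ = k ∧
  (∀ i j, M i j = 0 ∨ M i j = 1) ∧
  {q : ι × κ | M q.1 q.2 = 1}.encard + 2 = 2 * (k : ℕ∞) ∧
  ∃ T : SimpleGraph κ, T.IsTree ∧
    ∃ e : {i : ι // M i ≠ 0} ≃ T.edgeSet,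
      ∀ (i : {i : ι // M i ≠ 0}) (j : κ), M i j = 1 ↔ j ∈ (e i : Sym2 κ)

/-- For every `k`, all minimal dependencies of `k` columns of `M` are tree dependencies. -/
def MinimalDependenciesAreTrees {n : ℕ} (M : Matrix (Fin n) (Fin n) ℝ) : Prop :=
  ∀ (k : ℕ) (S : Finset (Fin n)), S.card = k →
    IsMinimalDependency k (columns M S) → IsTreeDependency k (columns M S)

end

end SparseRank

/-! Each nonzero row of a minimal dependency has at least two ones. If `#S - 1` independent rows
of a minimal dependency on the columns `S` have exactly two ones and the other rows vanish, it is
a tree dependency; so a non-tree dependency has excess ones, and while `#S * p ≤ 1 / 2` a union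
bound shows that this is unlikely. If `#S * p` is of constant order, each row has exactly one one
in `S` with probability bounded below, and such a row excludes a dependency. If `#S * p` is large
and `2 * #S ≤ n`, some `#S - 1` rows determine the kernel vector supported on `S`, and by the
Littlewood–Offord inequality the independent remaining rows are unlikely to be orthogonal to it.

If `B` and its transpose both have a minimal dependency on more than half of their columns, there
are a right and a left kernel vector with majority support. Each of the more than `n / 2` rows in
the support of the left one is a combination of the other rows, so that the kernel is determined
independently of this row, which by Littlewood–Offord is orthogonal to a given vector with
majority support with probability `O((n * p) ^ (-1 / 2))`. Markov's inequality for the number of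
these rows concludes.
-/

namespace SparseRank

noncomputable section

section ProductMeasure

variable {ι : Type*} [Fintype ι] [DecidableEq ι] {Ω : ι → Type*} [∀ i, MeasurableSpace (Ω i)]
  (μ : ∀ i, Measure (Ω i)) [∀ i, IsProbabilityMeasure (μ i)] (R : Finset ι)

lemma measurePreserving_piecewise :
    MeasurePreserving (fun x : (∀ i, Ω i) × (∀ i, Ω i) => R.piecewise x.1 x.2)
      ((Measure.pi μ).prod (Measure.pi μ)) (Measure.pi μ) := by
  have hmeas : Measurable fun x : (∀ i, Ω i) × (∀ i, Ω i) => R.piecewise x.1 x.2 := by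
    refine measurable_pi_lambda _ fun i => ?_
    by_cases hi : i ∈ R
    · simpa only [Finset.piecewise_eq_of_mem _ _ _ hi] using measurable_fst.eval
    · simpa only [Finset.piecewise_eq_of_notMem _ _ _ hi] using measurable_snd.eval
  refine ⟨hmeas, (Measure.pi_eq fun s hs => ?_).symm⟩
  have hbox : (fun x : (∀ i, Ω i) × (∀ i, Ω i) => R.piecewise x.1 x.2) ⁻¹' Set.univ.pi s =
      (R : Set ι).pi s ×ˢ ((Rᶜ : Finset ι) : Set ι).pi s := by
    ext x
    simp only [Set.mem_preimage, Set.mem_pi, Set.mem_univ, forall_true_left, Set.mem_prod,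
      Finset.mem_coe, Finset.mem_compl]
    refine ⟨fun h => ⟨fun i hi => ?_, fun i hi => ?_⟩, fun h i => ?_⟩
    · simpa only [Finset.piecewise_eq_of_mem _ _ _ hi] using h i
    · simpa only [Finset.piecewise_eq_of_notMem _ _ _ hi] using h i
    · by_cases hi : i ∈ R
      · simpa only [Finset.piecewise_eq_of_mem _ _ _ hi] using h.1 i hi
      · simpa only [Finset.piecewise_eq_of_notMem _ _ _ hi] using h.2 i hi
  rw [Measure.map_apply hmeas (.univ_pi hs), hbox, Measure.prod_prod, Measure.pi_pi_finset,
    Measure.pi_pi_finset, Finset.prod_mul_prod_compl]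

variable {R}

lemma measureReal_pi_le_of_forall_piecewise {A : Set (∀ i, Ω i)} (hA : MeasurableSet A) {c : ℝ}
    (h : ∀ g, (Measure.pi μ).real {f | R.piecewise g f ∈ A} ≤ c) : (Measure.pi μ).real A ≤ c := by
  obtain ⟨g⟩ := nonempty_of_isProbabilityMeasure (Measure.pi μ)
  have hc : 0 ≤ c := measureReal_nonneg.trans (h g)
  refine ENNReal.toReal_le_of_le_ofReal hc ?_
  rw [← (measurePreserving_piecewise μ R).measure_preimage hA.nullMeasurableSet,
    Measure.prod_apply ((measurePreserving_piecewise μ R).measurable hA)]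
  exact lintegral_le_const (ae_of_all _ fun g => (ENNReal.le_ofReal_iff_toReal_le
    (measure_ne_top _ _) hc).2 (h g))

lemma measureReal_pi_forall_notMem_le_pow {X : (∀ i, Ω i) → ∀ i, Set (Ω i)} {c : ℝ}
    (hX : ∀ f g, (∀ i ∈ R, f i = g i) → X f = X g) (hc : ∀ f, ∀ i ∉ R, (μ i).real (X f i) ≤ c)
    (hmeas : MeasurableSet {f | ∀ i ∉ R, f i ∈ X f i}) :
    (Measure.pi μ).real {f | ∀ i ∉ R, f i ∈ X f i} ≤ c ^ (Rᶜ).card := by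
  refine measureReal_pi_le_of_forall_piecewise μ (R := R) hmeas fun g => ?_
  have hbox : {f | R.piecewise g f ∈ {f | ∀ i ∉ R, f i ∈ X f i}} =
      ((Rᶜ : Finset ι) : Set ι).pi (X g) := by
    ext f
    have hXg : X (R.piecewise g f) = X g :=
      hX _ _ fun i hi => Finset.piecewise_eq_of_mem _ _ _ hi
    simp +contextual [hXg, Set.mem_pi]
  rw [hbox, measureReal_def, Measure.pi_pi_finset, ENNReal.toReal_prod, ← Finset.prod_const]
  exact Finset.prod_le_prod (fun _ _ => ENNReal.toReal_nonneg)
    fun i hi => hc g i (Finset.mem_compl.1 hi)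

end ProductMeasure

lemma mul_measureReal_le_sum {Ω κ : Type*} [MeasurableSpace Ω] {μ : Measure Ω} [IsFiniteMeasure μ]
    (s : Finset κ) {A : Set Ω} {B : κ → Set Ω} (hB : ∀ j ∈ s, MeasurableSet (B j)) {c : ℕ}
    (h : ∀ ω ∈ A, ∃ t ⊆ s, c ≤ t.card ∧ ∀ j ∈ t, ω ∈ B j) :
    c * μ.real A ≤ ∑ j ∈ s, μ.real (B j) := by
  have hint : ∀ j ∈ s, Integrable ((B j).indicator (1 : Ω → ℝ)) μ := fun j hj =>
    (integrable_const 1).indicator (hB j hj)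
  have hsub : A ⊆ {ω | (c : ℝ) ≤ ∑ j ∈ s, (B j).indicator 1 ω} := by
    intro ω hω
    obtain ⟨t, hts, hct, htB⟩ := h ω hω
    calc (c : ℝ) ≤ t.card := by exact_mod_cast hct
      _ = ∑ j ∈ t, (B j).indicator 1 ω := by
        simp only [Finset.sum_congr rfl fun j hj => Set.indicator_of_mem (htB j hj) (1 : Ω → ℝ),
          Pi.one_apply, Finset.sum_const, nsmul_eq_mul, mul_one]
      _ ≤ ∑ j ∈ s, (B j).indicator 1 ω :=
        Finset.sum_le_sum_of_subset_of_nonneg hts fun j _ _ =>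
          Set.indicator_nonneg (fun _ _ => zero_le_one) ω
  calc c * μ.real A ≤ c * μ.real {ω | (c : ℝ) ≤ ∑ j ∈ s, (B j).indicator 1 ω} :=
        mul_le_mul_of_nonneg_left (measureReal_mono hsub) (Nat.cast_nonneg c)
    _ ≤ ∫ ω, ∑ j ∈ s, (B j).indicator 1 ω ∂μ :=
        mul_meas_ge_le_integral_of_nonneg (ae_of_all _ fun ω => Finset.sum_nonneg fun j _ =>
          Set.indicator_nonneg (fun _ _ => zero_le_one) ω) (integrable_finsetSum s hint) c
    _ = ∑ j ∈ s, μ.real (B j) := by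
        rw [integral_finsetSum s hint]
        exact Finset.sum_congr rfl fun j hj => integral_indicator_one (hB j hj)

/-- The law of a `{0,1}`-row with independent Bernoulli(`p`) entries indexed by `κ`. -/
def rowLaw (κ : Type*) [Fintype κ] (p : unitInterval) : Measure (κ → Bool) :=
  Measure.pi fun _ => bernoulliMeasure true false p

instance (κ : Type*) [Fintype κ] (p : unitInterval) : IsProbabilityMeasure (rowLaw κ p) :=
  inferInstanceAs (IsProbabilityMeasure (Measure.pi _))

section Row

variable {κ : Type*} [Fintype κ]

/-- The set of positions at which a `{0,1}`-row has a one. -/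
def ones (ω : κ → Bool) : Finset κ := {j | ω j = true}

lemma mem_ones {ω : κ → Bool} {j : κ} : j ∈ ones ω ↔ ω j = true := by
  simp only [ones, Finset.mem_filter_univ]

variable {p : unitInterval} {S T : Finset κ}

lemma rowLaw_real_ones_inter_eq [DecidableEq κ] (hTS : T ⊆ S) :
    (rowLaw κ p).real {ω | ones ω ∩ S = T} = p ^ T.card * (1 - p) ^ (S.card - T.card) := by
  have hbox : {ω : κ → Bool | ones ω ∩ S = T} = (S : Set κ).pi fun j => {decide (j ∈ T)} := by
    ext ω
    have hentry (j : κ) : ω j = decide (j ∈ T) ↔ (j ∈ ones ω ↔ j ∈ T) := by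
      rw [Bool.eq_iff_iff, decide_eq_true_iff, mem_ones]
    simp only [Finset.ext_iff, Finset.mem_inter, Set.mem_ofPred_eq, Set.mem_pi, Finset.mem_coe,
      Set.mem_singleton_iff, hentry]
    exact ⟨fun h j hj => by simpa only [hj, and_true] using h j, fun h j =>
      ⟨fun hj => (h j hj.2).1 hj.1, fun hj => ⟨(h j (hTS hj)).2 hj, hTS hj⟩⟩⟩
  have hfactor (j : κ) : (bernoulliMeasure true false p).real {decide (j ∈ T)} =
      if j ∈ T then (p : ℝ) else 1 - p := by
    split_ifs with hj <;> simp [hj]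
  rw [hbox, measureReal_def, rowLaw, Measure.pi_pi_finset, ENNReal.toReal_prod,
    Finset.prod_congr rfl fun j _ => (measureReal_def _ _).symm.trans (hfactor j),
    Finset.prod_ite, Finset.prod_const, Finset.prod_const, Finset.filter_mem_eq_inter,
    Finset.inter_eq_right.2 hTS, Finset.filter_notMem_eq_sdiff, Finset.card_sdiff_of_subset hTS]

lemma rowLaw_real_subset_ones (T : Finset κ) :
    (rowLaw κ p).real {ω | T ⊆ ones ω} = p ^ T.card := by
  classical
  simpa only [Finset.inter_eq_right, Nat.sub_self, pow_zero, mul_one] using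
    rowLaw_real_ones_inter_eq (p := p) (Finset.Subset.refl T)

variable [DecidableEq κ]

lemma rowLaw_real_card_ones_inter_eq (S : Finset κ) (r : ℕ) :
    (rowLaw κ p).real {ω | (ones ω ∩ S).card = r} =
      S.card.choose r * (p ^ r * (1 - p) ^ (S.card - r)) := by
  have hunion : {ω : κ → Bool | (ones ω ∩ S).card = r} =
      ⋃ T ∈ S.powersetCard r, {ω | ones ω ∩ S = T} := by
    ext ω
    simp [Finset.mem_powersetCard]
  have hdisj : (S.powersetCard r : Set (Finset κ)).PairwiseDisjoint
      fun T => {ω : κ → Bool | ones ω ∩ S = T} := fun _ _ _ _ hne =>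
    Set.disjoint_left.2 fun ω hT hT' => hne (hT.symm.trans hT')
  rw [hunion, measureReal_biUnion_finset hdisj fun _ _ => .of_discrete]
  calc ∑ T ∈ S.powersetCard r, (rowLaw κ p).real {ω | ones ω ∩ S = T}
      = ∑ T ∈ S.powersetCard r, (p : ℝ) ^ r * (1 - p) ^ (S.card - r) :=
        Finset.sum_congr rfl fun T hT => by
          obtain ⟨hTS, hTr⟩ := Finset.mem_powersetCard.1 hT
          rw [rowLaw_real_ones_inter_eq hTS, hTr]
    _ = _ := by rw [Finset.sum_const, Finset.card_powersetCard, nsmul_eq_mul]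

lemma rowLaw_real_le_card_ones_inter_le (S : Finset κ) (r : ℕ) :
    (rowLaw κ p).real {ω | r ≤ (ones ω ∩ S).card} ≤ (S.card * p) ^ r := by
  have hsub : {ω : κ → Bool | r ≤ (ones ω ∩ S).card} ⊆
      ⋃ T ∈ S.powersetCard r, {ω | T ⊆ ones ω} := fun ω hω => by
    obtain ⟨T, hT, hTr⟩ := Finset.exists_subset_card_eq hω
    exact Set.mem_biUnion (Finset.mem_powersetCard.2 ⟨hT.trans Finset.inter_subset_right, hTr⟩)
      (hT.trans Finset.inter_subset_left)
  calc (rowLaw κ p).real {ω | r ≤ (ones ω ∩ S).card}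
      ≤ ∑ T ∈ S.powersetCard r, (rowLaw κ p).real {ω | T ⊆ ones ω} :=
        (measureReal_mono hsub (measure_ne_top _ _)).trans (measureReal_biUnion_finset_le _ _)
    _ = ∑ _T ∈ S.powersetCard r, (p : ℝ) ^ r := Finset.sum_congr rfl fun T hT => by
        rw [rowLaw_real_subset_ones, (Finset.mem_powersetCard.1 hT).2]
    _ = S.card.choose r * (p : ℝ) ^ r := by
        rw [Finset.sum_const, Finset.card_powersetCard, nsmul_eq_mul]
    _ ≤ (S.card * p) ^ r := by
        rw [mul_pow]
        gcongr
        · exact pow_nonneg p.2.1 r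
        · exact_mod_cast Nat.choose_le_pow S.card r

lemma rowLaw_real_card_ones_inter_ne_one_le (S : Finset κ) :
    (rowLaw κ p).real {ω | (ones ω ∩ S).card ≠ 1} ≤ 1 - S.card * p * (1 - p) ^ S.card := by
  have hpow : (1 - p : ℝ) ^ S.card ≤ (1 - p) ^ (S.card - 1) :=
    pow_le_pow_of_le_one (sub_nonneg.2 p.2.2) (sub_le_self _ p.2.1) (Nat.sub_le _ _)
  have hcompl : {ω : κ → Bool | (ones ω ∩ S).card ≠ 1} = {ω | (ones ω ∩ S).card = 1}ᶜ := rfl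
  rw [hcompl, probReal_compl_eq_one_sub .of_discrete, rowLaw_real_card_ones_inter_eq,
    Nat.choose_one_right, pow_one, ← mul_assoc]
  have := p.2.1
  gcongr

lemma rowLaw_real_card_ones_inter_ne_one_le_exp (hS : S.card * (p : ℝ) ≤ 1 / 2) :
    (rowLaw κ p).real {ω | (ones ω ∩ S).card ≠ 1} ≤ Real.exp (-(S.card * p / 2)) := by
  have hhalf : 1 / 2 ≤ (1 - p : ℝ) ^ S.card := by
    have := one_add_mul_le_pow (a := -(p : ℝ)) (by linarith [p.2.2]) S.card
    rw [← sub_eq_add_neg] at this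
    linarith
  have hk : 0 ≤ S.card * (p : ℝ) := mul_nonneg (Nat.cast_nonneg _) p.2.1
  calc (rowLaw κ p).real {ω | (ones ω ∩ S).card ≠ 1}
      ≤ 1 - S.card * p * (1 - p) ^ S.card := rowLaw_real_card_ones_inter_ne_one_le S
    _ ≤ -(S.card * p / 2) + 1 := by nlinarith
    _ ≤ Real.exp (-(S.card * p / 2)) := Real.add_one_le_exp _

lemma exp_neg_two_mul_le_one_sub {x : ℝ} (h0 : 0 ≤ x) (h1 : x ≤ 1 / 2) :
    Real.exp (-(2 * x)) ≤ 1 - x := by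
  rw [Real.exp_neg, inv_le_comm₀ (Real.exp_pos _) (by linarith)]
  refine le_trans ?_ (Real.add_one_le_exp _)
  rw [inv_le_iff_one_le_mul₀ (by linarith)]
  nlinarith

lemma rowLaw_real_card_ones_inter_ne_one_le_const (hp : (p : ℝ) ≤ 1 / 2) {M : ℝ}
    (hS : 1 / 2 ≤ S.card * (p : ℝ)) (hM : S.card * (p : ℝ) ≤ M) :
    (rowLaw κ p).real {ω | (ones ω ∩ S).card ≠ 1} ≤ 1 - Real.exp (-(2 * M)) / 2 := by
  have hexp : Real.exp (-(2 * M)) ≤ (1 - p : ℝ) ^ S.card :=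
    calc Real.exp (-(2 * M)) ≤ Real.exp (S.card * -(2 * p)) := Real.exp_le_exp.2 (by linarith)
      _ = Real.exp (-(2 * p)) ^ S.card := Real.exp_nat_mul _ _
      _ ≤ (1 - p) ^ S.card := by gcongr; exact exp_neg_two_mul_le_one_sub p.2.1 hp
  calc (rowLaw κ p).real {ω | (ones ω ∩ S).card ≠ 1}
      ≤ 1 - S.card * p * (1 - p) ^ S.card := rowLaw_real_card_ones_inter_ne_one_le S
    _ ≤ 1 - Real.exp (-(2 * M)) / 2 := by
        have := mul_le_mul hS hexp (Real.exp_pos _).le (by linarith)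
        linarith

end Row

section LittlewoodOfford

lemma norm_coeff_le_integral_circle (P : Polynomial ℂ) (j : ℕ) :
    ‖P.coeff j‖ ≤
      (2 * Real.pi)⁻¹ * ∫ θ in -Real.pi..Real.pi, ‖P.eval (Complex.exp (θ * Complex.I))‖ := by
  have : Fact (0 < 2 * Real.pi) := ⟨Real.two_pi_pos⟩
  have hexp (θ : ℝ) :
      ((AddCircle.toCircle (θ : AddCircle (2 * Real.pi)) : Circle) : ℂ) =
        Complex.exp (θ * Complex.I) := by
    rw [AddCircle.toCircle_apply_mk, div_self Real.two_pi_pos.ne', one_mul, Circle.coe_exp]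
  have heval (θ : ℝ) :
      P.toAddCircle (θ : AddCircle (2 * Real.pi)) = P.eval (Complex.exp (θ * Complex.I)) := by
    rw [← hexp]
    exact Polynomial.aeval_continuousMap_apply P _ _
  rw [← Polynomial.fourierCoeff_toAddCircle_natCast,
    fourierCoeff_eq_intervalIntegral _ _ (-Real.pi), norm_smul,
    show -Real.pi + 2 * Real.pi = Real.pi by ring, one_div, Real.norm_of_nonneg (by positivity)]
  gcongr
  refine (intervalIntegral.norm_integral_le_integral_norm (by linarith [Real.pi_pos])).trans_eq ?_
  simp only [norm_smul, fourier_apply, Circle.norm_coe, one_mul, heval]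

lemma norm_one_sub_add_mul_exp_le {p θ : ℝ} (h0 : 0 ≤ p) (h1 : p ≤ 1) (hθ : |θ| ≤ Real.pi) :
    ‖(1 - p : ℂ) + p * Complex.exp (θ * Complex.I)‖ ≤
      Real.exp (-(2 * p * (1 - p) / Real.pi ^ 2) * θ ^ 2) := by
  have hsq : ‖(1 - p : ℂ) + p * Complex.exp (θ * Complex.I)‖ ^ 2 =
      1 - 2 * p * (1 - p) * (1 - Real.cos θ) := by
    rw [← Complex.normSq_eq_norm_sq, Complex.normSq_apply]
    simp only [Complex.add_re, Complex.add_im, Complex.sub_re, Complex.sub_im, Complex.one_re,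
      Complex.one_im, Complex.re_ofReal_mul, Complex.im_ofReal_mul, Complex.ofReal_re,
      Complex.ofReal_im, Complex.exp_ofReal_mul_I_re, Complex.exp_ofReal_mul_I_im]
    linear_combination p ^ 2 * Real.sin_sq_add_cos_sq θ
  have hcos := Real.cos_le_one_sub_mul_cos_sq hθ
  refine (sq_le_sq₀ (norm_nonneg _) (Real.exp_pos _).le).1 ?_
  calc ‖(1 - p : ℂ) + p * Complex.exp (θ * Complex.I)‖ ^ 2
      = 1 - 2 * p * (1 - p) * (1 - Real.cos θ) := hsq
    _ ≤ 1 - 2 * p * (1 - p) * (2 / Real.pi ^ 2 * θ ^ 2) := by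
        have : 0 ≤ 2 * p * (1 - p) := mul_nonneg (by linarith) (by linarith)
        gcongr
        linarith
    _ = 2 * (-(2 * p * (1 - p) / Real.pi ^ 2) * θ ^ 2) + 1 := by ring
    _ ≤ Real.exp (2 * (-(2 * p * (1 - p) / Real.pi ^ 2) * θ ^ 2)) := Real.add_one_le_exp _
    _ = Real.exp (-(2 * p * (1 - p) / Real.pi ^ 2) * θ ^ 2) ^ 2 := by
        rw [← Real.exp_nat_mul, Nat.cast_ofNat]

lemma intervalIntegral_exp_neg_mul_sq_le {b : ℝ} (hb : 0 < b) {a c : ℝ} (hac : a ≤ c) :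
    ∫ θ in a..c, Real.exp (-b * θ ^ 2) ≤ √(Real.pi / b) := by
  rw [intervalIntegral.integral_of_le hac, ← integral_gaussian]
  exact setIntegral_le_integral (integrable_exp_neg_mul_sq hb)
    (ae_of_all _ fun _ => (Real.exp_pos _).le)

lemma choose_mul_pow_mul_pow_le {m : ℕ} (j : ℕ) {p : ℝ} (h0 : 0 < p) (h1 : p < 1) (hm : 0 < m) :
    m.choose j * (p ^ j * (1 - p) ^ (m - j)) ≤
      (2 * Real.pi)⁻¹ * √(Real.pi / (m * (2 * p * (1 - p) / Real.pi ^ 2))) := by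
  let P : Polynomial ℂ :=
    ((Polynomial.X + Polynomial.C (1 - p : ℂ)) ^ m).comp (Polynomial.C (p : ℂ) * Polynomial.X)
  have hcoeff : ‖P.coeff j‖ = m.choose j * (p ^ j * (1 - p) ^ (m - j)) := by
    rw [Polynomial.comp_C_mul_X_coeff, Polynomial.coeff_X_add_C_pow, ← Complex.ofReal_one,
      ← Complex.ofReal_sub, norm_mul, norm_mul, norm_pow, norm_pow, Complex.norm_natCast,
      Complex.norm_of_nonneg h0.le, Complex.norm_of_nonneg (sub_pos.2 h1).le]
    ring
  have heval (z : ℂ) : P.eval z = ((1 - p : ℂ) + p * z) ^ m := by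
    simp only [P, Polynomial.eval_comp, Polynomial.eval_pow, Polynomial.eval_add,
      Polynomial.eval_mul, Polynomial.eval_X, Polynomial.eval_C, add_comm]
  have hb : 0 < m * (2 * p * (1 - p) / Real.pi ^ 2) := by
    have := sub_pos.2 h1
    positivity
  have hπ : -Real.pi ≤ Real.pi := by linarith [Real.pi_pos]
  rw [← hcoeff]
  refine (norm_coeff_le_integral_circle P j).trans ?_
  gcongr
  refine le_trans ?_ (intervalIntegral_exp_neg_mul_sq_le hb hπ)
  refine intervalIntegral.integral_mono_on hπ (Continuous.intervalIntegrable (by fun_prop) _ _)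
    (Continuous.intervalIntegrable (by fun_prop) _ _) fun θ hθ => ?_
  calc ‖P.eval (Complex.exp (θ * Complex.I))‖
      = ‖(1 - p : ℂ) + p * Complex.exp (θ * Complex.I)‖ ^ m := by rw [heval, norm_pow]
    _ ≤ Real.exp (-(2 * p * (1 - p) / Real.pi ^ 2) * θ ^ 2) ^ m := by
        gcongr
        exact norm_one_sub_add_mul_exp_le h0.le h1.le (abs_le.2 hθ)
    _ = Real.exp (-(m * (2 * p * (1 - p) / Real.pi ^ 2)) * θ ^ 2) := by
        rw [← Real.exp_nat_mul]
        ring_nf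

lemma choose_mul_pow_mul_pow_le_inv_sqrt {m : ℕ} (j : ℕ) {p : ℝ} (h0 : 0 < p) (h1 : p ≤ 1 / 2)
    (hm : 0 < m) : m.choose j * (p ^ j * (1 - p) ^ (m - j)) ≤ (√(m * p))⁻¹ := by
  have := Real.pi_pos
  have : (0 : ℝ) < m := Nat.cast_pos.2 hm
  have hq : 1 - p ≠ 0 := by linarith
  refine (choose_mul_pow_mul_pow_le j h0 (by linarith) hm).trans
    ((le_inv_mul_iff₀ (by positivity)).2 ?_ |>.trans_eq (mul_one _))
  calc √(m * p) * ((2 * Real.pi)⁻¹ * √(Real.pi / (m * (2 * p * (1 - p) / Real.pi ^ 2))))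
      = (2 * Real.pi)⁻¹ * √(Real.pi ^ 3 / (2 * (1 - p))) := by
        rw [mul_left_comm, ← Real.sqrt_mul (by positivity)]
        congr 2
        field_simp
    _ ≤ (2 * Real.pi)⁻¹ * (2 * Real.pi) := by
        gcongr
        refine Real.sqrt_le_iff.2
          ⟨by positivity, (div_le_self (by positivity) (by linarith)).trans ?_⟩
        nlinarith [Real.pi_le_four, sq_nonneg Real.pi]
    _ = 1 := inv_mul_cancel₀ (by positivity)

variable {κ : Type*}

lemma sum_inv_choose_card_le_one {S : Finset κ} {𝒜 : Finset (Finset κ)}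
    (h𝒜 : IsAntichain (· ⊆ ·) (𝒜 : Set (Finset κ))) (hS : ∀ T ∈ 𝒜, T ⊆ S) :
    ∑ T ∈ 𝒜, (S.card.choose T.card : ℝ)⁻¹ ≤ 1 := by
  classical
  let toSub (T : Finset κ) : Finset S := T.subtype (· ∈ S)
  have hmap (T) (hT : T ∈ 𝒜) : (toSub T).map (Function.Embedding.subtype _) = T :=
    Finset.subtype_map_of_mem fun _ hx => hS T hT hx
  have hinj : Set.InjOn toSub 𝒜 := fun T hT T' hT' h => by
    rw [← hmap T hT, ← hmap T' hT', h]
  have hanti : IsAntichain (· ⊆ ·) ((𝒜.image toSub : Finset (Finset S)) : Set (Finset S)) := by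
    rw [Finset.coe_image]
    rintro _ ⟨T, hT, rfl⟩ _ ⟨T', hT', rfl⟩ hne hsub
    refine h𝒜 hT hT' (fun h => hne (congrArg toSub h)) ?_
    rw [← hmap T hT, ← hmap T' hT']
    exact Finset.map_subset_map.2 hsub
  have hLYM := Finset.lubell_yamamoto_meshalkin_inequality_sum_inv_choose (𝕜 := ℝ) hanti
  rw [Finset.sum_image hinj, Fintype.card_coe] at hLYM
  refine le_of_eq_of_le (Finset.sum_congr rfl fun T hT => ?_) hLYM
  rw [← Finset.card_map (Function.Embedding.subtype _), hmap T hT]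

variable {z : κ → ℝ}

lemma isAntichain_sum_eq {S : Finset κ} (hz : ∀ j ∈ S, 0 < z j) (a : ℝ) :
    IsAntichain (· ⊆ ·) {T : Finset κ | T ⊆ S ∧ ∑ j ∈ T, z j = a} := by
  rintro T ⟨-, hT⟩ T' ⟨hT'S, hT'⟩ hne hsub
  obtain ⟨j, hjT', hjT⟩ := Finset.exists_of_ssubset (hsub.ssubset_of_ne hne)
  refine (Finset.sum_lt_sum_of_subset hsub hjT' hjT (hz j (hT'S hjT')) fun i hi _ =>
    (hz i (hT'S hi)).le).ne (hT.trans hT'.symm)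

variable [Fintype κ] {p : unitInterval}

lemma rowLaw_real_ones_inter_mem_le [DecidableEq κ] {S : Finset κ} {𝒜 : Finset (Finset κ)}
    (h𝒜 : IsAntichain (· ⊆ ·) (𝒜 : Set (Finset κ))) (hS : ∀ T ∈ 𝒜, T ⊆ S) (h0 : 0 < (p : ℝ))
    (h1 : (p : ℝ) ≤ 1 / 2) (hpos : 0 < S.card) :
    (rowLaw κ p).real {ω | ones ω ∩ S ∈ 𝒜} ≤ (√(S.card * p))⁻¹ := by
  have hunion : {ω : κ → Bool | ones ω ∩ S ∈ 𝒜} = ⋃ T ∈ 𝒜, {ω | ones ω ∩ S = T} := by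
    ext ω
    simp only [Set.mem_ofPred_eq, Set.mem_iUnion, exists_prop, exists_eq_right']
  calc (rowLaw κ p).real {ω | ones ω ∩ S ∈ 𝒜}
      ≤ ∑ T ∈ 𝒜, (rowLaw κ p).real {ω | ones ω ∩ S = T} := by
        rw [hunion]
        exact measureReal_biUnion_finset_le _ _
    _ ≤ ∑ T ∈ 𝒜, (√(S.card * p))⁻¹ * (S.card.choose T.card : ℝ)⁻¹ :=
        Finset.sum_le_sum fun T hT => by
          have hchoose : (0 : ℝ) < S.card.choose T.card :=
            Nat.cast_pos.2 (Nat.choose_pos (Finset.card_le_card (hS T hT)))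
          rw [rowLaw_real_ones_inter_eq (hS T hT), ← div_eq_mul_inv, le_div_iff₀' hchoose]
          exact choose_mul_pow_mul_pow_le_inv_sqrt _ h0 h1 hpos
    _ ≤ (√(S.card * p))⁻¹ := by
        rw [← Finset.mul_sum]
        exact mul_le_of_le_one_right (inv_nonneg.2 (Real.sqrt_nonneg _))
          (sum_inv_choose_card_le_one h𝒜 hS)

lemma rowLaw_real_sum_ones_inter_eq_le [DecidableEq κ] {S : Finset κ} (hz : ∀ j ∈ S, 0 < z j)
    (a : ℝ) (h0 : 0 < (p : ℝ)) (h1 : (p : ℝ) ≤ 1 / 2) (hS : 0 < S.card) :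
    (rowLaw κ p).real {ω | ∑ j ∈ ones ω ∩ S, z j = a} ≤ (√(S.card * p))⁻¹ := by
  have h𝒜 : (({T ∈ S.powerset | ∑ j ∈ T, z j = a} : Finset (Finset κ)) : Set (Finset κ)) =
      {T | T ⊆ S ∧ ∑ j ∈ T, z j = a} := by
    simp only [Finset.coe_filter, Finset.mem_powerset]
  refine le_of_eq_of_le ?_ (rowLaw_real_ones_inter_mem_le (h𝒜 ▸ isAntichain_sum_eq hz a)
    (fun T hT => Finset.mem_powerset.1 (Finset.mem_filter.1 hT).1) h0 h1 hS)
  simp only [Finset.mem_filter, Finset.mem_powerset, Finset.inter_subset_right, true_and]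

lemma rowLaw_real_sum_ones_eq_le_of_pos {S : Finset κ} (hz : ∀ j ∈ S, 0 < z j)
    (a : ℝ) (h0 : 0 < (p : ℝ)) (h1 : (p : ℝ) ≤ 1 / 2) (hS : 0 < S.card) :
    (rowLaw κ p).real {ω | ∑ j ∈ ones ω, z j = a} ≤ (√(S.card * p))⁻¹ := by
  classical
  refine measureReal_pi_le_of_forall_piecewise _ (R := Sᶜ) .of_discrete fun g => ?_
  have hsplit (f : κ → Bool) : ∑ j ∈ ones (Sᶜ.piecewise g f), z j =
      ∑ j ∈ ones g \ S, z j + ∑ j ∈ ones f ∩ S, z j := by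
    have hones : ones (Sᶜ.piecewise g f) = (ones g \ S) ∪ (ones f ∩ S) := by
      ext j
      by_cases hj : j ∈ S <;> simp [mem_ones, Finset.piecewise, hj]
    exact hones ▸ Finset.sum_union (Finset.disjoint_left.2 fun j hj hj' =>
      (Finset.mem_sdiff.1 hj).2 (Finset.mem_inter.1 hj').2)
  have hlevel : {f | Sᶜ.piecewise g f ∈ {ω | ∑ j ∈ ones ω, z j = a}} =
      {f | ∑ j ∈ ones f ∩ S, z j = a - ∑ j ∈ ones g \ S, z j} := by
    ext f
    rw [Set.mem_ofPred_eq, Set.mem_ofPred_eq, Set.mem_ofPred_eq, hsplit, eq_sub_iff_add_eq']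
  rw [hlevel]
  exact rowLaw_real_sum_ones_inter_eq_le hz _ h0 h1 hS

lemma rowLaw_real_sum_ones_eq_le {S : Finset κ} (hz : ∀ j ∈ S, z j ≠ 0) (a : ℝ)
    (h0 : 0 < (p : ℝ)) (h1 : (p : ℝ) ≤ 1 / 2) (hS : 0 < S.card) :
    (rowLaw κ p).real {ω | ∑ j ∈ ones ω, z j = a} ≤ (√(S.card * p / 2))⁻¹ := by
  classical
  wlog hmaj : S.card ≤ 2 * {j ∈ S | 0 < z j}.card generalizing z a
  · have hneg : {j ∈ S | ¬ 0 < z j} = {j ∈ S | 0 < -z j} := Finset.filter_congr fun j hj => by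
      rw [not_lt, neg_pos]
      exact ⟨fun h => h.lt_of_ne (hz j hj), le_of_lt⟩
    have hcard := S.card_filter_add_card_filter_not (0 < z ·)
    simpa only [Finset.sum_neg_distrib, neg_inj] using
      this (z := fun j => -z j) (fun j hj => neg_ne_zero.2 (hz j hj)) (-a) (by rw [← hneg]; lia)
  refine (rowLaw_real_sum_ones_eq_le_of_pos (S := {j ∈ S | 0 < z j})
    (fun j hj => (Finset.mem_filter.1 hj).2) a h0 h1 (by lia)).trans ?_
  have hmaj' : (S.card : ℝ) ≤ 2 * ({j ∈ S | 0 < z j}.card : ℝ) := by exact_mod_cast hmaj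
  have : (0 : ℝ) < S.card := Nat.cast_pos.2 hS
  gcongr
  nlinarith

end LittlewoodOfford

section Dependency

variable {ι κ : Type*} {k : ℕ} {M : Matrix ι κ ℝ}

/-- The graph on the columns of a `{0,1}`-matrix in which two columns are adjacent if some row
has a one in both; for a tree dependency this is the tree. -/
def columnGraph (M : Matrix ι κ ℝ) : SimpleGraph κ where
  Adj u v := u ≠ v ∧ ∃ i, M i u = 1 ∧ M i v = 1
  symm := ⟨fun _ _ ⟨h, i, hu, hv⟩ => ⟨h.symm, i, hv, hu⟩⟩
  loopless := ⟨fun _ h => h.1 rfl⟩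

lemma exists_columnGraph_edge {i : ι} (h2 : {j | M i j = 1}.ncard = 2) :
    ∃ e : (columnGraph M).edgeSet, ∀ j, M i j = 1 ↔ j ∈ (e : Sym2 κ) := by
  obtain ⟨u, v, huv, he⟩ := Set.ncard_eq_two.1 h2
  have hmem (j : κ) : M i j = 1 ↔ j = u ∨ j = v := Set.ext_iff.1 he j
  exact ⟨⟨s(u, v), huv, i, (hmem u).2 (.inl rfl), (hmem v).2 (.inr rfl)⟩, fun j => by
    rw [hmem, Sym2.mem_iff]⟩

lemma exists_row_of_mem_edgeSet {e : Sym2 κ} (he : e ∈ (columnGraph M).edgeSet) :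
    ∃ i, M i ≠ 0 ∧ ∀ e' : Sym2 κ, (∀ j, M i j = 1 ↔ j ∈ e') → e' = e := by
  induction e using Sym2.ind with
  | _ u v =>
    obtain ⟨huv, i, hu, hv⟩ := he
    exact ⟨i, fun h0 => one_ne_zero (hu.symm.trans (congrFun h0 u)), fun e' he' =>
      (Sym2.mem_and_mem_iff huv).1 ⟨(he' u).1 hu, (he' v).1 hv⟩⟩

lemma ncard_setOf_eq_one_eq_sum [Fintype ι] [Finite κ] (M : Matrix ι κ ℝ) :
    {q : ι × κ | M q.1 q.2 = 1}.ncard = ∑ i, {j | M i j = 1}.ncard :=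
  (Nat.card_congr (Equiv.subtypeProdEquivSigmaSubtype fun i j => M i j = 1)).trans
    Nat.card_sigma

lemma encard_setOf_eq_one_eq_two_mul [Finite ι] [Finite κ]
    (h2 : ∀ i, M i ≠ 0 → {j | M i j = 1}.ncard = 2) :
    {q : ι × κ | M q.1 q.2 = 1}.encard = 2 * ({i | M i ≠ 0}.ncard : ℕ∞) := by
  have := Fintype.ofFinite ι
  have hfin := Set.toFinite {i | M i ≠ 0}
  have hzero (i) (hi : i ∉ hfin.toFinset) : {j | M i j = 1}.ncard = 0 := by
    have hMi : M i = 0 := by simpa using hi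
    simp [hMi]
  rw [← (Set.toFinite _).cast_ncard_eq, ncard_setOf_eq_one_eq_sum,
    ← Finset.sum_subset (Finset.subset_univ hfin.toFinset) fun i _ => hzero i,
    Finset.sum_const_nat fun i hi => h2 i (hfin.mem_toFinset.1 hi),
    Set.ncard_eq_toFinset_card _ hfin, Nat.cast_mul, mul_comm, Nat.cast_ofNat]

variable [Fintype κ]

lemma IsMinimalDependency.eq_smul (h : IsMinimalDependency k M) {x : κ → ℝ}
    (hx : M.mulVec x = 0) (hx0 : x ≠ 0) {y : κ → ℝ} (hy : M.mulVec y = 0) :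
    ∃ c : ℝ, y = c • x := by
  obtain ⟨hk, -, hrank⟩ := h
  have hker : Module.finrank ℝ (LinearMap.ker M.mulVecLin) = 1 := by
    have hsum := LinearMap.finrank_range_add_finrank_ker M.mulVecLin
    rw [Module.finrank_fintype_fun_eq_card, hk] at hsum
    change Module.finrank ℝ (LinearMap.range M.mulVecLin) + 1 = k at hrank
    lia
  obtain ⟨c, hc⟩ := (finrank_eq_one_iff_of_nonzero' (⟨x, hx⟩ : LinearMap.ker M.mulVecLin)
    fun h0 => hx0 (congrArg Subtype.val h0)).1 hker ⟨y, hy⟩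
  exact ⟨c, (congrArg Subtype.val hc).symm⟩

-- A row only meets one connected component of the column graph.
lemma mulVec_ite_reachable_eq_zero (h01 : ∀ i j, M i j = 0 ∨ M i j = 1) {x : κ → ℝ}
    (hx : M.mulVec x = 0) (u : κ) [DecidablePred ((columnGraph M).Reachable u)] :
    M.mulVec (fun j => if (columnGraph M).Reachable u j then x j else 0) = 0 := by
  ext i
  change ∑ j, M i j * _ = 0
  by_cases hi : ∃ w, M i w = 1 ∧ (columnGraph M).Reachable u w
  · obtain ⟨w, hw, huw⟩ := hi
    have hxi : ∑ j, M i j * x j = 0 := congrFun hx i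
    refine (Finset.sum_congr rfl fun j _ => ?_).trans hxi
    rcases h01 i j with hj | hj
    · rw [hj, zero_mul, zero_mul]
    · have hwj : (columnGraph M).Reachable w j := by
        obtain rfl | hne := eq_or_ne w j
        · rfl
        · exact SimpleGraph.Adj.reachable ⟨hne, i, hw, hj⟩
      rw [if_pos (huw.trans hwj)]
  · push Not at hi
    refine Finset.sum_eq_zero fun j _ => ?_
    rcases h01 i j with hj | hj
    · rw [hj, zero_mul]
    · rw [if_neg (hi j hj), mul_zero]

lemma IsMinimalDependency.columnGraph_connected (h : IsMinimalDependency k M)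
    (h01 : ∀ i j, M i j = 0 ∨ M i j = 1) : (columnGraph M).Connected := by
  classical
  obtain ⟨x, hx, hx0⟩ := h.2.1
  have : Nonempty κ := by
    rw [← Fintype.card_pos_iff, h.1, ← h.2.2]
    lia
  refine ⟨fun u v => ?_⟩
  obtain ⟨c, hc⟩ := h.eq_smul hx (fun h0 => hx0 u (congrFun h0 u))
    (mulVec_ite_reachable_eq_zero h01 hx u)
  have hu : x u = c * x u := by simpa using congrFun hc u
  by_contra huv
  have hv : c * x v = 0 := by simpa [huv] using (congrFun hc v).symm
  rw [(mul_eq_zero.1 hv).resolve_right (hx0 v), zero_mul] at hu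
  exact hx0 u hu

-- The `k - 1` nonzero rows map onto the edges of a connected graph on `k` vertices, so the map
-- is bijective and the graph is a tree.
lemma IsMinimalDependency.isTreeDependency [Finite ι] (h : IsMinimalDependency k M)
    (h01 : ∀ i j, M i j = 0 ∨ M i j = 1) (h2 : ∀ i, M i ≠ 0 → {j | M i j = 1}.ncard = 2)
    (hcard : {i | M i ≠ 0}.ncard + 1 = k) : IsTreeDependency k M := by
  have hconn := h.columnGraph_connected h01
  choose edge hedge using fun i : {i // M i ≠ 0} => exists_columnGraph_edge (h2 i i.2)
  have hsurj : edge.Surjective := fun e => by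
    obtain ⟨i, hi, huniq⟩ := exists_row_of_mem_edgeSet e.2
    exact ⟨⟨i, hi⟩, Subtype.ext (huniq _ (hedge ⟨i, hi⟩))⟩
  have hrows : Nat.card {i // M i ≠ 0} + 1 = Nat.card κ := by
    rw [Nat.card_eq_fintype_card (α := κ), h.1, ← hcard]
    rfl
  have hle := hconn.card_vert_le_card_edgeSet_add_one
  have hge := Nat.card_le_card_of_surjective edge hsurj
  refine ⟨h.1, h01, ?_, columnGraph M, ?_, Equiv.ofBijective edge ?_, hedge⟩
  · rw [encard_setOf_eq_one_eq_two_mul h2, ← hcard]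
    push_cast
    ring
  · exact SimpleGraph.isTree_iff_connected_and_card.2 ⟨hconn, by lia⟩
  · exact (Nat.bijective_iff_surjective_and_card edge).2 ⟨hsurj, by lia⟩

lemma exists_rows_card_eq_rank [Finite ι] (M : Matrix ι κ ℝ) :
    ∃ R : Finset ι, R.card = M.rank ∧ (∀ i ∈ R, M i ≠ 0) ∧
      ∀ x, (∀ i ∈ R, M.mulVec x i = 0) → M.mulVec x = 0 := by
  classical
  obtain ⟨τ, row, hinj, hspan, hli⟩ := exists_linearIndependent' ℝ M.row
  have := Fintype.ofFinite ι
  have := Fintype.ofInjective row hinj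
  refine ⟨Finset.univ.image row, ?_, ?_, fun x hx => ?_⟩
  · rw [Finset.card_image_of_injective _ hinj, Finset.card_univ, ← finrank_span_eq_card hli, hspan,
      ← Matrix.rank_eq_finrank_span_row]
  · rintro i hi
    obtain ⟨t, -, rfl⟩ := Finset.mem_image.1 hi
    exact hli.ne_zero t
  · have hker : Submodule.span ℝ (Set.range M.row) ≤
        LinearMap.ker ((dotProductBilin ℝ ℝ).flip x) := by
      rw [← hspan, Submodule.span_le]
      rintro _ ⟨t, rfl⟩
      exact hx _ (Finset.mem_image_of_mem row (Finset.mem_univ t))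
    exact funext fun i => hker (Submodule.subset_span ⟨i, rfl⟩)

lemma IsMinimalDependency.ncard_ne_one (h : IsMinimalDependency k M)
    (h01 : ∀ i j, M i j = 0 ∨ M i j = 1) (i : ι) : {j | M i j = 1}.ncard ≠ 1 := by
  intro h1
  obtain ⟨x, hx, hx0⟩ := h.2.1
  obtain ⟨j, hj⟩ := Set.ncard_eq_one.1 h1
  have hmem (l : κ) : M i l = 1 ↔ l = j := Set.ext_iff.1 hj l
  have hxi : ∑ l, M i l * x l = 0 := congrFun hx i
  rw [Finset.sum_eq_single j (fun l _ hl => by rw [(h01 i l).resolve_right (mt (hmem l).1 hl),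
    zero_mul]) (by simp), (hmem j).2 rfl, one_mul] at hxi
  exact hx0 j hxi

/-- A lower bound for the numbers of ones in the rows of a minimal dependency that is not a tree
dependency: two ones in each row of `R`, and in row `i₀` one more, or two if `i₀ ∉ R`. -/
def excessDemand [DecidableEq ι] (R : Finset ι) (i₀ : ι) (i : ι) : ℕ :=
  (if i ∈ R then 2 else 0) + if i = i₀ then if i₀ ∈ R then 1 else 2 else 0

lemma IsMinimalDependency.exists_excessDemand_le [Finite ι] [DecidableEq ι]
    (h : IsMinimalDependency k M) (h01 : ∀ i j, M i j = 0 ∨ M i j = 1)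
    (ht : ¬ IsTreeDependency k M) :
    ∃ (R : Finset ι) (i₀ : ι), R.card + 1 = k ∧
      ∀ i, excessDemand R i₀ i ≤ {j | M i j = 1}.ncard := by
  obtain ⟨R, hrank, hR0, -⟩ := exists_rows_card_eq_rank M
  have hcard : R.card + 1 = k := by rw [hrank, h.2.2]
  have hzero (i : ι) : M i = 0 ↔ {j | M i j = 1}.ncard = 0 := by
    rw [Set.ncard_eq_zero]
    refine ⟨fun h0 => by simp [h0], fun h0 => funext fun j => (h01 i j).resolve_right ?_⟩
    exact Set.eq_empty_iff_forall_notMem.1 h0 j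
  have hne1 := h.ncard_ne_one h01
  have hR2 (i) (hi : i ∈ R) : 2 ≤ {j | M i j = 1}.ncard := by
    have hpos := mt (hzero i).2 (hR0 i hi)
    have hne := hne1 i
    lia
  suffices ∃ i₀, (if i₀ ∈ R then 3 else 2) ≤ {j | M i₀ j = 1}.ncard by
    obtain ⟨i₀, hi₀⟩ := this
    refine ⟨R, i₀, hcard, fun i => ?_⟩
    unfold excessDemand
    grind
  by_contra! hlt
  have hR (i : ι) : i ∈ R ↔ M i ≠ 0 := by
    refine ⟨hR0 i, fun hi => ?_⟩
    by_contra hiR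
    have hpos := mt (hzero i).2 hi
    have hne := hne1 i
    have hlt2 := hlt i
    rw [if_neg hiR] at hlt2
    lia
  refine ht (h.isTreeDependency h01 (fun i hi => ?_) ?_)
  · have hiR := (hR i).2 hi
    have hlt3 := hlt i
    rw [if_pos hiR] at hlt3
    exact le_antisymm (Nat.lt_succ_iff.1 hlt3) (hR2 i hiR)
  · rw [← hcard, ← Set.ncard_coe_finset]
    congr
    exact Set.ext fun i => (hR i).symm

end Dependency

section ZeroOne

variable {ι κ : Type*}

/-- The real `{0,1}`-matrix whose rows have the given patterns of ones. -/
def rowMatrix (f : ι → κ → Bool) : Matrix ι κ ℝ :=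
  Matrix.of fun i j => if f i j = true then 1 else 0

lemma columns_rowMatrix_eq_zero_or_eq_one (f : ι → κ → Bool) (S : Finset κ) (i : ι) (j : S) :
    columns (rowMatrix f) S i j = 0 ∨ columns (rowMatrix f) S i j = 1 :=
  (ite_eq_or_eq _ _ _).symm

variable [Fintype κ]

lemma rowMatrix_mulVec (f : ι → κ → Bool) (z : κ → ℝ) (i : ι) :
    (rowMatrix f).mulVec z i = ∑ j ∈ ones (f i), z j := by
  rw [ones, Finset.sum_filter]
  exact Finset.sum_congr rfl fun j _ => ite_zero_mul .. |>.trans (by rw [one_mul])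

lemma ncard_columns_rowMatrix_eq_one [DecidableEq κ] (f : ι → κ → Bool) (S : Finset κ) (i : ι) :
    {j | columns (rowMatrix f) S i j = 1}.ncard = (ones (f i) ∩ S).card := by
  rw [← Set.ncard_image_of_injective _ Subtype.val_injective, ← Set.ncard_coe_finset]
  congr
  ext j
  simp [columns, rowMatrix, mem_ones]

lemma columns_mulVec (M : Matrix ι κ ℝ) {S : Finset κ} {z : κ → ℝ} (hz : ∀ j ∉ S, z j = 0) :
    (columns M S).mulVec (fun j => z j) = M.mulVec z := by
  ext i
  change ∑ j : S, M i j * z j = ∑ j, M i j * z j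
  rw [Finset.sum_coe_sort S fun j => M i j * z j]
  exact Finset.sum_subset (Finset.subset_univ S) fun j _ hj => by rw [hz j hj, mul_zero]

variable {k : ℕ} {M : Matrix ι κ ℝ} {S : Finset κ}

lemma IsMinimalDependency.exists_mulVec_eq_zero (h : IsMinimalDependency k (columns M S)) :
    ∃ z : κ → ℝ, (∀ j, z j ≠ 0 ↔ j ∈ S) ∧ M.mulVec z = 0 := by
  classical
  obtain ⟨x, hx, hx0⟩ := h.2.1
  let z (j : κ) : ℝ := if hj : j ∈ S then x ⟨j, hj⟩ else 0
  have hzx : (fun j : S => z j) = x := funext fun j => dif_pos j.2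
  have hz (j) (hj : j ∉ S) : z j = 0 := dif_neg hj
  refine ⟨z, fun j => ⟨fun hj => ?_, fun hj => ?_⟩, ?_⟩
  · by_contra hjS
    exact hj (hz j hjS)
  · exact (congrFun hzx ⟨j, hj⟩).trans_ne (hx0 _)
  · rw [← columns_mulVec M hz, hzx, hx]

lemma IsMinimalDependency.exists_rows_determine_kernel [Finite ι]
    (h : IsMinimalDependency k (columns M S)) :
    ∃ R : Finset ι, R.card + 1 = k ∧
      ∀ z : κ → ℝ, (∀ j ∉ S, z j = 0) → (∀ i ∈ R, M.mulVec z i = 0) → M.mulVec z = 0 := by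
  obtain ⟨R, hR, -, hker⟩ := exists_rows_card_eq_rank (columns M S)
  refine ⟨R, by rw [hR, h.2.2], fun z hz hzR => ?_⟩
  rw [← columns_mulVec M hz] at hzR ⊢
  exact hker _ hzR

end ZeroOne

section MatrixLaw

variable {ι κ : Type*} [Fintype ι] [Fintype κ] {p : unitInterval}

/-- The law of a random `{0,1}`-matrix with independent Bernoulli(`p`) entries, presented as an
independent family of rows. -/
def matrixLaw (ι κ : Type*) [Fintype ι] [Fintype κ] (p : unitInterval) : Measure (ι → κ → Bool) :=
  Measure.pi fun _ => rowLaw κ p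

instance (ι κ : Type*) [Fintype ι] [Fintype κ] (p : unitInterval) :
    IsProbabilityMeasure (matrixLaw ι κ p) :=
  inferInstanceAs (IsProbabilityMeasure (Measure.pi _))

lemma matrixLaw_singleton (f : ι → κ → Bool) :
    matrixLaw ι κ p {f} = ∏ i, ∏ j, bernoulliMeasure true false p {f i j} := by
  simp only [matrixLaw, rowLaw, Measure.pi_singleton]

lemma measurePreserving_swap :
    MeasurePreserving Function.swap (matrixLaw ι κ p) (matrixLaw κ ι p) := by
  refine ⟨.of_discrete, Measure.ext_of_singleton fun f => ?_⟩
  have hpre : Function.swap ⁻¹' {f} = {Function.swap f} :=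
    Set.ext fun _ => ⟨congrArg Function.swap, congrArg Function.swap⟩
  rw [Measure.map_apply .of_discrete (.singleton f), hpre, matrixLaw_singleton, Finset.prod_comm,
    matrixLaw_singleton]

lemma measurePreserving_curry (n : ℕ) (p : unitInterval) :
    MeasurePreserving Function.curry (bernoulliLaw n p) (matrixLaw (Fin n) (Fin n) p) := by
  refine ⟨.of_discrete, Measure.ext_of_singleton fun f => ?_⟩
  have hpre : Function.curry ⁻¹' {f} = {Function.uncurry f} :=
    Set.ext fun _ => ⟨congrArg Function.uncurry, congrArg Function.curry⟩
  rw [Measure.map_apply .of_discrete (.singleton f), hpre, bernoulliLaw, Measure.pi_singleton,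
    Fintype.prod_prod_type, matrixLaw_singleton]
  rfl

end MatrixLaw

section FixedColumns

variable {ι κ : Type*} [Fintype κ] {p : unitInterval} {S : Finset κ}

/-- The event that the columns in `S` form a minimal dependency that is not a tree dependency. -/
def nonTreeDependency (ι : Type*) (S : Finset κ) : Set (ι → κ → Bool) :=
  {f | IsMinimalDependency S.card (columns (rowMatrix f) S) ∧
    ¬ IsTreeDependency S.card (columns (rowMatrix f) S)}

lemma card_ones_inter_ne_one_of_mem_nonTreeDependency [DecidableEq κ] {f : ι → κ → Bool}
    (hf : f ∈ nonTreeDependency ι S) (i : ι) : (ones (f i) ∩ S).card ≠ 1 := by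
  rw [← ncard_columns_rowMatrix_eq_one]
  exact hf.1.ncard_ne_one (columns_rowMatrix_eq_zero_or_eq_one f S) i

variable [Fintype ι]

lemma matrixLaw_real_forall_mem (X : ι → Set (κ → Bool)) :
    (matrixLaw ι κ p).real {f | ∀ i, f i ∈ X i} = ∏ i, (rowLaw κ p).real (X i) := by
  have hbox : {f : ι → κ → Bool | ∀ i, f i ∈ X i} = Set.univ.pi X := by
    simp only [Set.pi, Set.mem_univ, forall_true_left]
  rw [hbox, measureReal_def, matrixLaw, Measure.pi_pi, ENNReal.toReal_prod]
  rfl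

lemma sum_excessDemand [DecidableEq ι] (R : Finset ι) (i₀ : ι) :
    ∑ i, excessDemand R i₀ i = 2 * R.card + if i₀ ∈ R then 1 else 2 := by
  simp only [excessDemand, Finset.sum_add_distrib, Finset.sum_ite_mem, Finset.univ_inter,
    Finset.sum_const, smul_eq_mul, mul_comm, Finset.sum_ite_eq', Finset.mem_univ, if_true]

lemma card_le_card_excessDemand_eq_zero_add [DecidableEq ι] (R : Finset ι) (i₀ : ι) :
    Fintype.card ι ≤ ({i | excessDemand R i₀ i = 0} : Finset ι).card + (R.card + 1) := by
  have hsub : ({i | ¬ excessDemand R i₀ i = 0} : Finset ι) ⊆ insert i₀ R := fun i hi => by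
    rw [Finset.mem_filter_univ, excessDemand] at hi
    grind
  rw [← Finset.card_univ, ← Finset.card_filter_add_card_filter_not (excessDemand R i₀ · = 0)]
  gcongr
  exact (Finset.card_le_card hsub).trans (Finset.card_insert_le _ _)

lemma rowLaw_real_demand_le [DecidableEq κ] (hS : S.card * (p : ℝ) ≤ 1 / 2) (r : ℕ) :
    (rowLaw κ p).real {ω | (ones ω ∩ S).card ≠ 1 ∧ r ≤ (ones ω ∩ S).card} ≤
      (S.card * (p : ℝ)) ^ r * if r = 0 then Real.exp (-(S.card * p / 2)) else 1 := by
  split_ifs with hr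
  · subst hr
    simpa only [zero_le, and_true, pow_zero, one_mul] using
      rowLaw_real_card_ones_inter_ne_one_le_exp hS
  · rw [mul_one]
    exact (measureReal_mono fun ω hω => hω.2).trans (rowLaw_real_le_card_ones_inter_le S r)

lemma matrixLaw_real_forall_demand_le [DecidableEq κ] (hS : S.card * (p : ℝ) ≤ 1 / 2) (c : ι → ℕ) :
    (matrixLaw ι κ p).real {f | ∀ i, (ones (f i) ∩ S).card ≠ 1 ∧ c i ≤ (ones (f i) ∩ S).card} ≤
      (S.card * (p : ℝ)) ^ (∑ i, c i) *
        Real.exp (-(S.card * (p : ℝ) / 2)) ^ ({i | c i = 0} : Finset ι).card := by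
  refine (matrixLaw_real_forall_mem fun i =>
    {ω | (ones ω ∩ S).card ≠ 1 ∧ c i ≤ (ones ω ∩ S).card}).trans_le ?_
  refine (Finset.prod_le_prod (fun _ _ => measureReal_nonneg) fun i _ =>
    rowLaw_real_demand_le hS (c i)).trans_eq ?_
  rw [Finset.prod_mul_distrib, Finset.prod_pow_eq_pow_sum, Finset.prod_ite, Finset.prod_const,
    Finset.prod_const_one, mul_one]

lemma nonTreeDependency_subset_iUnion_demand [DecidableEq ι] [DecidableEq κ] {m : ℕ}
    (hS : S.card = m + 1) :
    nonTreeDependency ι S ⊆ ⋃ R ∈ Finset.univ.powersetCard m, ⋃ i₀ ∈ Finset.univ,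
      {f | ∀ i, (ones (f i) ∩ S).card ≠ 1 ∧ excessDemand R i₀ i ≤ (ones (f i) ∩ S).card} := by
  intro f hf
  obtain ⟨R, i₀, hR, hdemand⟩ :=
    hf.1.exists_excessDemand_le (columns_rowMatrix_eq_zero_or_eq_one f S) hf.2
  have hRm : R.card = m := by lia
  refine Set.mem_biUnion (Finset.mem_powersetCard_univ.2 hRm)
    (Set.mem_biUnion (Finset.mem_univ i₀) fun i =>
      ⟨card_ones_inter_ne_one_of_mem_nonTreeDependency hf i, ?_⟩)
  exact ncard_columns_rowMatrix_eq_one f S i ▸ hdemand i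

lemma matrixLaw_real_excessDemand_le [DecidableEq ι] [DecidableEq κ] {q : ℝ}
    (hSq : S.card * (p : ℝ) = q) (hq : q ≤ 1 / 2) {R : Finset ι}
    (hR : 2 * (R.card + 1) ≤ Fintype.card ι) (i₀ : ι) :
    (matrixLaw ι κ p).real {f | ∀ i, (ones (f i) ∩ S).card ≠ 1 ∧
      excessDemand R i₀ i ≤ (ones (f i) ∩ S).card} ≤
      q ^ (2 * R.card) * Real.exp (-(q * Fintype.card ι / 4)) * if i₀ ∈ R then q else q ^ 2 := by
  have hq0 : 0 ≤ q := hSq ▸ mul_nonneg (Nat.cast_nonneg _) p.2.1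
  have hzero : (Fintype.card ι : ℝ) ≤ 2 * ({i | excessDemand R i₀ i = 0} : Finset ι).card := by
    have := card_le_card_excessDemand_eq_zero_add R i₀
    exact_mod_cast (by lia)
  have hexp : Real.exp (-(q / 2)) ^ ({i | excessDemand R i₀ i = 0} : Finset ι).card ≤
      Real.exp (-(q * Fintype.card ι / 4)) := by
    rw [← Real.exp_nat_mul, Real.exp_le_exp]
    nlinarith
  subst hSq
  refine (matrixLaw_real_forall_demand_le hq (excessDemand R i₀)).trans ?_
  rw [sum_excessDemand, pow_add, mul_right_comm]
  have hite : (S.card * (p : ℝ)) ^ (if i₀ ∈ R then 1 else 2) =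
      if i₀ ∈ R then S.card * (p : ℝ) else (S.card * (p : ℝ)) ^ 2 := by
    split_ifs <;> ring
  rw [hite]
  gcongr

lemma matrixLaw_real_nonTreeDependency_le_of_small {m : ℕ} (hS : S.card = m + 1) {q : ℝ}
    (hSq : (m + 1) * (p : ℝ) = q) (hq : q ≤ 1 / 2) (hm : 2 * (m + 1) ≤ Fintype.card ι) :
    (matrixLaw ι κ p).real (nonTreeDependency ι S) ≤ (Fintype.card ι).choose m *
      (q ^ (2 * m) * Real.exp (-(q * Fintype.card ι / 4)) * (m * q + Fintype.card ι * q ^ 2)) := by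
  classical
  have hq0 : 0 ≤ q := hSq ▸ mul_nonneg (by positivity) p.2.1
  have hsum (R : Finset ι) : ∑ i₀, (if i₀ ∈ R then q else q ^ 2) ≤
      R.card * q + Fintype.card ι * q ^ 2 := by
    rw [Finset.sum_ite, Finset.sum_const, Finset.sum_const, Finset.filter_mem_eq_inter,
      Finset.univ_inter, nsmul_eq_mul, nsmul_eq_mul]
    gcongr
    exact Finset.card_filter_le _ _
  calc (matrixLaw ι κ p).real (nonTreeDependency ι S)
      ≤ ∑ R ∈ Finset.univ.powersetCard m, ∑ i₀ : ι, (matrixLaw ι κ p).real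
          {f | ∀ i, (ones (f i) ∩ S).card ≠ 1 ∧
            excessDemand R i₀ i ≤ (ones (f i) ∩ S).card} :=
        (measureReal_mono (nonTreeDependency_subset_iUnion_demand hS) (measure_ne_top _ _)).trans <|
          (measureReal_biUnion_finset_le _ _).trans <| Finset.sum_le_sum fun _ _ =>
            measureReal_biUnion_finset_le _ _
    _ ≤ ∑ R ∈ (Finset.univ : Finset ι).powersetCard m,
          q ^ (2 * m) * Real.exp (-(q * Fintype.card ι / 4)) *
            (m * q + Fintype.card ι * q ^ 2) := by
        refine Finset.sum_le_sum fun R hR => ?_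
        obtain rfl := Finset.mem_powersetCard_univ.1 hR
        refine (Finset.sum_le_sum fun i₀ _ => matrixLaw_real_excessDemand_le
          (by rw [hS]; exact_mod_cast hSq) hq hm i₀).trans ?_
        rw [← Finset.mul_sum]
        gcongr
        exact hsum R
    _ = _ := by
        rw [Finset.sum_const, Finset.card_powersetCard, Finset.card_univ, nsmul_eq_mul]

lemma matrixLaw_real_nonTreeDependency_le_of_moderate (hp : (p : ℝ) ≤ 1 / 2) {M : ℝ}
    (hS : 1 / 2 ≤ S.card * (p : ℝ)) (hM : S.card * (p : ℝ) ≤ M) :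
    (matrixLaw ι κ p).real (nonTreeDependency ι S) ≤
      (1 - Real.exp (-(2 * M)) / 2) ^ Fintype.card ι := by
  classical
  calc (matrixLaw ι κ p).real (nonTreeDependency ι S)
      ≤ (matrixLaw ι κ p).real {f | ∀ i, f i ∈ {ω | (ones ω ∩ S).card ≠ 1}} :=
        measureReal_mono fun f hf => card_ones_inter_ne_one_of_mem_nonTreeDependency hf
    _ = (rowLaw κ p).real {ω | (ones ω ∩ S).card ≠ 1} ^ Fintype.card ι := by
        rw [matrixLaw_real_forall_mem, Finset.prod_const, Finset.card_univ]
    _ ≤ (1 - Real.exp (-(2 * M)) / 2) ^ Fintype.card ι := by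
        gcongr
        exact rowLaw_real_card_ones_inter_ne_one_le_const hp hS hM

end FixedColumns

section Kernel

variable {ι κ : Type*} [Fintype κ] {p : unitInterval} {S : Finset κ}

/-- The event that the kernel contains a vector of `Z`, and that this can already be read off the
rows in `R`: every vector of `Z` orthogonal to those rows is in the kernel. -/
def kernelDeterminedBy (R : Finset ι) (Z : Set (κ → ℝ)) : Set (ι → κ → Bool) :=
  {f | (∃ z ∈ Z, (rowMatrix f).mulVec z = 0) ∧
    ∀ z ∈ Z, (∀ i ∈ R, (rowMatrix f).mulVec z i = 0) → (rowMatrix f).mulVec z = 0}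

lemma nonTreeDependency_subset_iUnion_kernelDeterminedBy [Finite ι] (S : Finset κ) :
    nonTreeDependency ι S ⊆ ⋃ R ∈ {R : Finset ι | R.card + 1 = S.card},
      kernelDeterminedBy R {z | ∀ j, z j ≠ 0 ↔ j ∈ S} := by
  intro f hf
  obtain ⟨z, hz, hfz⟩ := hf.1.exists_mulVec_eq_zero
  obtain ⟨R, hR, hdet⟩ := hf.1.exists_rows_determine_kernel
  exact Set.mem_biUnion hR ⟨⟨z, hz, hfz⟩, fun z' hz' =>
    hdet z' fun j hj => by_contra fun h => hj ((hz' j).1 h)⟩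

variable [Fintype ι]

-- A vector of `Z` orthogonal to the rows in `R` can be chosen as a function of these rows, and
-- the remaining rows are independent of it.
lemma matrixLaw_real_kernelDeterminedBy_le [DecidableEq ι] (R : Finset ι) {Z : Set (κ → ℝ)} {c : ℝ}
    (hc : 0 ≤ c) (hZ : ∀ z ∈ Z, (rowLaw κ p).real {ω | ∑ j ∈ ones ω, z j = 0} ≤ c) :
    (matrixLaw ι κ p).real (kernelDeterminedBy R Z) ≤ c ^ (Rᶜ).card := by
  let candidates (f : ι → κ → Bool) : Set (κ → ℝ) := {z ∈ Z | ∀ i ∈ R, ∑ j ∈ ones (f i), z j = 0}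
  let choice (f : ι → κ → Bool) : κ → ℝ := Classical.epsilon (· ∈ candidates f)
  let X (f : ι → κ → Bool) (_ : ι) : Set (κ → Bool) :=
    {ω | choice f ∈ Z ∧ ∑ j ∈ ones ω, choice f j = 0}
  have hX (f g : ι → κ → Bool) (hfg : ∀ i ∈ R, f i = g i) : X f = X g := by
    have hcand : candidates f = candidates g := Set.ext fun z =>
      and_congr_right fun _ => forall₂_congr fun i hi => by rw [hfg i hi]
    simp only [X, choice, hcand]
  have hXc (f) (i : ι) (_ : i ∉ R) : (rowLaw κ p).real (X f i) ≤ c := by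
    by_cases h : choice f ∈ Z
    · simpa only [X, h, true_and] using hZ _ h
    · simpa only [X, h, false_and, Set.ofPred_false, measureReal_empty] using hc
  refine (measureReal_mono ?_).trans
    (measureReal_pi_forall_notMem_le_pow _ hX hXc .of_discrete)
  rintro f ⟨⟨z, hz, hfz⟩, hdet⟩ i -
  have hchoice : choice f ∈ candidates f := Classical.epsilon_spec (p := (· ∈ candidates f))
    ⟨z, hz, fun i _ => by rw [← rowMatrix_mulVec, hfz, Pi.zero_apply]⟩
  have hker := hdet _ hchoice.1 fun i hi => (rowMatrix_mulVec f _ i).trans (hchoice.2 i hi)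
  exact ⟨hchoice.1, (rowMatrix_mulVec f _ i).symm.trans (congrFun hker i)⟩

-- `8192 = 2 * 64 ^ 2` makes the small-ball probability of each row at most `1 / 64`, enough to
-- beat the at most `2 ^ n` choices of `R`, and later those of `S`.
lemma matrixLaw_real_nonTreeDependency_le_of_large (hp : (p : ℝ) ≤ 1 / 2)
    (hS : 8192 ≤ S.card * (p : ℝ)) (hcard : 2 * S.card ≤ Fintype.card ι) :
    (matrixLaw ι κ p).real (nonTreeDependency ι S) ≤ (1 / 4) ^ Fintype.card ι := by
  classical
  have hpos : 0 < S.card * (p : ℝ) := by linarith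
  have hS0 : 0 < S.card := Nat.pos_of_ne_zero fun h => by simp [h] at hpos
  have hp0 : 0 < (p : ℝ) := pos_of_mul_pos_right hpos (Nat.cast_nonneg _)
  have hrow (z : κ → ℝ) (hz : ∀ j, z j ≠ 0 ↔ j ∈ S) :
      (rowLaw κ p).real {ω | ∑ j ∈ ones ω, z j = 0} ≤ 1 / 64 := by
    refine (rowLaw_real_sum_ones_eq_le (fun j hj => (hz j).2 hj) 0 hp0 hp hS0).trans ?_
    rw [← one_div]
    gcongr
    exact Real.le_sqrt_of_sq_le (by linarith)
  have hpow (R : Finset ι) (hR : R.card + 1 = S.card) :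
      (1 / 64 : ℝ) ^ (Rᶜ).card ≤ (1 / 8) ^ Fintype.card ι := by
    have hle : Fintype.card ι ≤ 2 * (Rᶜ).card := by
      rw [Finset.card_compl]
      lia
    calc (1 / 64 : ℝ) ^ (Rᶜ).card = (1 / 8) ^ (2 * (Rᶜ).card) := by rw [pow_mul]; norm_num
      _ ≤ (1 / 8) ^ Fintype.card ι := pow_le_pow_of_le_one (by norm_num) (by norm_num) hle
  calc (matrixLaw ι κ p).real (nonTreeDependency ι S)
      ≤ ∑ R : Finset ι with R.card + 1 = S.card, (matrixLaw ι κ p).real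
          (kernelDeterminedBy R {z | ∀ j, z j ≠ 0 ↔ j ∈ S}) := by
        refine (measureReal_mono ?_ (measure_ne_top _ _)).trans (measureReal_biUnion_finset_le _ _)
        simpa using nonTreeDependency_subset_iUnion_kernelDeterminedBy S
    _ ≤ ∑ R : Finset ι with R.card + 1 = S.card, (1 / 8 : ℝ) ^ Fintype.card ι :=
        Finset.sum_le_sum fun R hR => (matrixLaw_real_kernelDeterminedBy_le R (by norm_num)
          hrow).trans (hpow R (Finset.mem_filter.1 hR).2)
    _ ≤ 2 ^ Fintype.card ι * (1 / 8) ^ Fintype.card ι := by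
        rw [Finset.sum_const, nsmul_eq_mul]
        gcongr
        exact_mod_cast (Finset.card_filter_le _ _).trans_eq (by simp)
    _ = (1 / 4) ^ Fintype.card ι := by rw [← mul_pow]; norm_num

-- If `w` is in the left kernel, each row with `w i₀ ≠ 0` is a combination of the other rows.
lemma mulVec_eq_zero_of_transpose_mulVec_eq_zero [DecidableEq ι] {M : Matrix ι κ ℝ} {w : ι → ℝ}
    (hw : M.transpose.mulVec w = 0) {i₀ : ι} (hi₀ : w i₀ ≠ 0) {z : κ → ℝ}
    (hz : ∀ i ∈ Finset.univ.erase i₀, M.mulVec z i = 0) : M.mulVec z = 0 := by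
  have hsum : w ⬝ᵥ M.mulVec z = 0 := by
    rw [Matrix.dotProduct_mulVec, ← Matrix.mulVec_transpose, hw, zero_dotProduct]
  have hne (i : ι) (hi : i ≠ i₀) : M.mulVec z i = 0 := hz i (by simp [hi])
  have hi₀z : w i₀ * M.mulVec z i₀ = 0 := by
    rwa [dotProduct, Finset.sum_eq_single i₀ (fun i _ hi => by rw [hne i hi, mul_zero])
      (by simp)] at hsum
  ext i
  obtain rfl | hi := eq_or_ne i i₀
  · exact (mul_eq_zero.1 hi₀z).resolve_left hi₀
  · exact hne i hi

/-- The vectors with more than half of their coordinates nonzero. -/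
def majoritySupport (κ : Type*) [Fintype κ] : Set (κ → ℝ) :=
  {z | Fintype.card κ < 2 * ({j | z j ≠ 0} : Finset κ).card}

lemma rowLaw_real_sum_ones_eq_zero_le_of_mem_majoritySupport (hp0 : 0 < (p : ℝ))
    (hp : (p : ℝ) ≤ 1 / 2) {z : κ → ℝ} (hz : z ∈ majoritySupport κ) :
    (rowLaw κ p).real {ω | ∑ j ∈ ones ω, z j = 0} ≤ (√(Fintype.card κ * p / 4))⁻¹ := by
  have hz' : Fintype.card κ < 2 * ({j | z j ≠ 0} : Finset κ).card := hz
  have hpos : 0 < ({j | z j ≠ 0} : Finset κ).card := by lia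
  obtain ⟨j, -⟩ := Finset.card_pos.1 hpos
  have hcard : 0 < (Fintype.card κ : ℝ) := by exact_mod_cast Fintype.card_pos_iff.2 ⟨j⟩
  have hhalf : (Fintype.card κ : ℝ) ≤ 2 * ({j | z j ≠ 0} : Finset κ).card := by
    exact_mod_cast hz'.le
  refine (rowLaw_real_sum_ones_eq_le (fun j hj => (Finset.mem_filter.1 hj).2) 0 hp0 hp
    hpos).trans ?_
  gcongr ?_⁻¹
  refine Real.sqrt_le_sqrt ?_
  nlinarith

lemma matrixLaw_real_majoritySupport_kernels_le (hp0 : 0 < (p : ℝ)) (hp : (p : ℝ) ≤ 1 / 2) :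
    (matrixLaw ι κ p).real {f | (∃ z ∈ majoritySupport κ, (rowMatrix f).mulVec z = 0) ∧
      ∃ w ∈ majoritySupport ι, (rowMatrix f).transpose.mulVec w = 0} ≤
      2 * (√(Fintype.card κ * p / 4))⁻¹ := by
  classical
  set ε : ℝ := (√(Fintype.card κ * p / 4))⁻¹
  have hdet (i₀ : ι) : (matrixLaw ι κ p).real
      (kernelDeterminedBy (Finset.univ.erase i₀) (majoritySupport κ)) ≤ ε := by
    simpa using matrixLaw_real_kernelDeterminedBy_le (Finset.univ.erase i₀)
      (show 0 ≤ ε by positivity)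
      fun z hz => rowLaw_real_sum_ones_eq_zero_le_of_mem_majoritySupport hp0 hp hz
  have hcount := (mul_measureReal_le_sum (μ := matrixLaw ι κ p)
    (A := {f | (∃ z ∈ majoritySupport κ, (rowMatrix f).mulVec z = 0) ∧
      ∃ w ∈ majoritySupport ι, (rowMatrix f).transpose.mulVec w = 0})
    (B := fun i₀ => kernelDeterminedBy (Finset.univ.erase i₀) (majoritySupport κ)) Finset.univ
    (fun _ _ => .of_discrete) (c := Fintype.card ι / 2 + 1) ?_).trans
    (Finset.sum_le_card_nsmul _ _ ε fun i₀ _ => hdet i₀)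
  · have hhalf : (Fintype.card ι : ℝ) ≤ 2 * (Fintype.card ι / 2 + 1 : ℕ) := by
      exact_mod_cast (by lia : Fintype.card ι ≤ 2 * (Fintype.card ι / 2 + 1))
    refine le_of_mul_le_mul_left (hcount.trans ?_) (by positivity)
    rw [nsmul_eq_mul, Finset.card_univ, ← mul_assoc, mul_comm _ (2 : ℝ)]
    gcongr
  · rintro f ⟨hker, w, hw, hfw⟩
    have hw' : Fintype.card ι < 2 * ({i | w i ≠ 0} : Finset ι).card := hw
    exact ⟨({i | w i ≠ 0} : Finset ι), Finset.subset_univ _, by lia, fun i₀ hi₀ => ⟨hker, fun z _ =>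
      mulVec_eq_zero_of_transpose_mulVec_eq_zero hfw (Finset.mem_filter.1 hi₀).2⟩⟩

end Kernel

section UnionBounds

lemma choose_succ_mul_choose_le (n m : ℕ) :
    (n.choose (m + 1) : ℝ) * n.choose m ≤ (m + 1) * n ^ (2 * m + 1) / (m + 1).factorial ^ 2 := by
  have hfact : ((m + 1).factorial : ℝ) = (m + 1) * m.factorial := by
    exact_mod_cast Nat.factorial_succ m
  calc (n.choose (m + 1) : ℝ) * n.choose m
      ≤ n ^ (m + 1) / (m + 1).factorial * (n ^ m / m.factorial) := by
        gcongr <;> exact Nat.choose_le_pow_div _ _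
    _ = (m + 1) * n ^ (2 * m + 1) / (m + 1).factorial ^ 2 := by
        rw [hfact]
        field_simp
        ring

lemma pow_mul_self_div_factorial_le (k : ℕ) {d : ℝ} (hd : 0 ≤ d) :
    (k * d) ^ k / k.factorial ≤ (Real.exp 1 * d) ^ k := by
  calc (k * d) ^ k / k.factorial = (k : ℝ) ^ k / k.factorial * d ^ k := by ring
    _ ≤ Real.exp k * d ^ k := by
        gcongr
        exact Real.pow_div_factorial_le_exp _ (Nat.cast_nonneg k) k
    _ = (Real.exp 1 * d) ^ k := by rw [mul_pow, Real.exp_one_pow]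

/-- The small dependencies on `k` columns contribute at most the `k`-th power of this number to the
union bound, where `d` is the mean number of ones in a row. -/
def smallRatio (d : ℝ) : ℝ :=
  2 * (Real.exp 1 * d) ^ 2 * Real.exp (-(d / 4))

lemma choose_mul_small_bound_le {n m : ℕ} {d q : ℝ} (hd : 1 ≤ d) (hq0 : 0 ≤ q)
    (hq : n * q = (m + 1 : ℕ) * d) :
    n.choose (m + 1) * (n.choose m *
      (q ^ (2 * m) * Real.exp (-(q * n / 4)) * (m * q + n * q ^ 2))) ≤
      smallRatio d ^ (m + 1) := by
  have hmq : m * q ≤ n * q ^ 2 := by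
    rw [sq, ← mul_assoc, hq]
    push_cast
    gcongr
    nlinarith [(Nat.cast_nonneg m : (0 : ℝ) ≤ m)]
  have htwo : 2 * ((m + 1 : ℕ) : ℝ) ≤ 2 ^ (m + 1) := by
    rw [pow_succ']
    gcongr
    exact_mod_cast Nat.lt_two_pow_self (n := m)
  have hexp : Real.exp (-(q * n / 4)) = Real.exp (-(d / 4)) ^ (m + 1) := by
    rw [mul_comm q, hq, ← Real.exp_nat_mul]
    congr 1
    ring
  calc n.choose (m + 1) * (n.choose m *
        (q ^ (2 * m) * Real.exp (-(q * n / 4)) * (m * q + n * q ^ 2)))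
      = n.choose (m + 1) * n.choose m *
        (q ^ (2 * m) * Real.exp (-(q * n / 4)) * (m * q + n * q ^ 2)) := (mul_assoc _ _ _).symm
    _ ≤ (m + 1) * n ^ (2 * m + 1) / (m + 1).factorial ^ 2 *
        (q ^ (2 * m) * Real.exp (-(q * n / 4)) * (2 * (n * q ^ 2))) := by
        gcongr
        · exact choose_succ_mul_choose_le n m
        · linarith
    _ = 2 * (m + 1 : ℕ) * ((n * q) ^ (m + 1) / (m + 1).factorial) ^ 2 *
          Real.exp (-(d / 4)) ^ (m + 1) := by
        rw [hexp]
        push_cast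
        ring
    _ ≤ 2 ^ (m + 1) * ((Real.exp 1 * d) ^ (m + 1)) ^ 2 * Real.exp (-(d / 4)) ^ (m + 1) := by
        rw [hq]
        gcongr
        exact pow_mul_self_div_factorial_le (m + 1) (by linarith)
    _ = smallRatio d ^ (m + 1) := by
        rw [smallRatio]
        ring

variable {ι : Type*} [Fintype ι] {p : unitInterval}

lemma card_card_le_mul_rpow_le {x : ℝ} (hx0 : 0 < x) (hx1 : x ≤ 1) (t : ℝ) :
    ({S | (S.card : ℝ) ≤ t} : Finset (Finset ι)).card * x ^ t ≤ (1 + x) ^ Fintype.card ι := by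
  calc ({S | (S.card : ℝ) ≤ t} : Finset (Finset ι)).card * x ^ t
      = ∑ S : Finset ι with (S.card : ℝ) ≤ t, x ^ t := by rw [Finset.sum_const, nsmul_eq_mul]
    _ ≤ ∑ S : Finset ι with (S.card : ℝ) ≤ t, x ^ S.card := by
        refine Finset.sum_le_sum fun S hS => ?_
        rw [← Real.rpow_natCast]
        exact Real.rpow_le_rpow_of_exponent_ge hx0 hx1 (Finset.mem_filter.1 hS).2
    _ ≤ ∑ S : Finset ι, x ^ S.card :=
        Finset.sum_le_sum_of_subset_of_nonneg (Finset.filter_subset _ _) fun _ _ _ => by positivity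
    _ = (1 + x) ^ Fintype.card ι := by
        simpa only [one_pow, mul_one, add_comm] using Fintype.sum_pow_mul_eq_add_pow ι x 1

-- Weighting the sets by `(c / 2) ^ S.card` makes their total weight `(1 + c / 2) ^ n`, which
-- `(1 - c) ^ n` absorbs.
lemma card_card_le_mul_one_sub_pow_le {c : ℝ} (hc0 : 0 < c) (hc1 : c ≤ 1) (t : ℝ) :
    ({S | (S.card : ℝ) ≤ t} : Finset (Finset ι)).card * (1 - c) ^ Fintype.card ι ≤
      (1 - c / 2) ^ Fintype.card ι * (c / 2) ^ (-t) := by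
  have hcount := card_card_le_mul_rpow_le (ι := ι) (half_pos hc0) (by linarith) t
  rw [← le_div_iff₀ (by positivity), div_eq_mul_inv, ← Real.rpow_neg (by positivity)] at hcount
  have : 0 ≤ 1 - c := sub_nonneg.2 hc1
  calc _ ≤ (1 + c / 2) ^ Fintype.card ι * (c / 2) ^ (-t) * (1 - c) ^ Fintype.card ι := by gcongr
    _ = ((1 + c / 2) * (1 - c)) ^ Fintype.card ι * (c / 2) ^ (-t) := by
        rw [mul_pow]
        ring
    _ ≤ (1 - c / 2) ^ Fintype.card ι * (c / 2) ^ (-t) := by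
        gcongr
        nlinarith

lemma sum_range_pow_succ_le_two_mul {x : ℝ} (hx0 : 0 ≤ x) (hx : x ≤ 1 / 2) (n : ℕ) :
    ∑ m ∈ Finset.range n, x ^ (m + 1) ≤ 2 * x := by
  calc ∑ m ∈ Finset.range n, x ^ (m + 1) ≤ ∑ m ∈ Finset.range n, x * (1 / 2) ^ m := by
        refine Finset.sum_le_sum fun m _ => ?_
        rw [pow_succ']
        gcongr
    _ ≤ 2 * x := by
        rw [← Finset.mul_sum, mul_comm]
        gcongr
        exact sum_geometric_two_le n

lemma matrixLaw_real_exists_nonTreeDependency_le (P : Finset ι → Prop) [DecidablePred P] :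
    (matrixLaw ι ι p).real {f | ∃ S, P S ∧ f ∈ nonTreeDependency ι S} ≤
      ∑ S with P S, (matrixLaw ι ι p).real (nonTreeDependency ι S) := by
  refine (measureReal_mono ?_ (measure_ne_top _ _)).trans (measureReal_biUnion_finset_le _ _)
  rintro f ⟨S, hS, hf⟩
  exact Set.mem_biUnion (by simpa using hS) hf

lemma sum_matrixLaw_real_nonTreeDependency_le_of_small {m : ℕ} {d : ℝ}
    (hd : Fintype.card ι * (p : ℝ) = d) (hd1 : 1 ≤ d) (hmp : (m + 1) * (p : ℝ) ≤ 1 / 2)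
    (hm : 2 * (m + 1) ≤ Fintype.card ι) :
    ∑ S ∈ Finset.univ.powersetCard (m + 1), (matrixLaw ι ι p).real (nonTreeDependency ι S) ≤
      smallRatio d ^ (m + 1) := by
  classical
  refine (Finset.sum_le_card_nsmul _ _ _ fun S hS =>
    matrixLaw_real_nonTreeDependency_le_of_small (Finset.mem_powersetCard_univ.1 hS) rfl hmp
      hm).trans ?_
  rw [Finset.card_powersetCard, Finset.card_univ, nsmul_eq_mul]
  exact choose_mul_small_bound_le hd1 (mul_nonneg (by positivity) p.2.1)
    (by rw [← hd]; push_cast; ring)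

lemma matrixLaw_real_exists_small_le {d : ℝ} (hd : Fintype.card ι * (p : ℝ) = d) (hd1 : 1 ≤ d)
    (hratio : smallRatio d ≤ 1 / 2) :
    (matrixLaw ι ι p).real {f | ∃ S, (S.card * (p : ℝ) ≤ 1 / 2 ∧ 2 * S.card ≤ Fintype.card ι) ∧
      f ∈ nonTreeDependency ι S} ≤ 2 * smallRatio d := by
  classical
  have hratio0 : 0 ≤ smallRatio d := by
    rw [smallRatio]
    positivity
  let sizes : Finset ℕ := {m ∈ Finset.range (Fintype.card ι) |
    (m + 1) * (p : ℝ) ≤ 1 / 2 ∧ 2 * (m + 1) ≤ Fintype.card ι}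
  have hsub : {f : ι → ι → Bool | ∃ S : Finset ι,
      (S.card * (p : ℝ) ≤ 1 / 2 ∧ 2 * S.card ≤ Fintype.card ι) ∧ f ∈ nonTreeDependency ι S} ⊆
      ⋃ m ∈ sizes, ⋃ S ∈ Finset.univ.powersetCard (m + 1), nonTreeDependency ι S := by
    rintro f ⟨S, ⟨hSp, hSn⟩, hf⟩
    obtain ⟨m, hcard⟩ : ∃ m, m + 1 = S.card := ⟨_, hf.1.2.2⟩
    rw [← hcard] at hSp hSn
    push_cast at hSp
    exact Set.mem_biUnion (Finset.mem_filter.2 ⟨Finset.mem_range.2 (by lia), hSp, hSn⟩)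
      (Set.mem_biUnion (Finset.mem_powersetCard_univ.2 hcard.symm) hf)
  calc _ ≤ ∑ m ∈ sizes, ∑ S ∈ Finset.univ.powersetCard (m + 1),
        (matrixLaw ι ι p).real (nonTreeDependency ι S) :=
        (measureReal_mono hsub (measure_ne_top _ _)).trans <|
          (measureReal_biUnion_finset_le _ _).trans <| Finset.sum_le_sum fun _ _ =>
            measureReal_biUnion_finset_le _ _
    _ ≤ ∑ m ∈ sizes, smallRatio d ^ (m + 1) := Finset.sum_le_sum fun m hm =>
        have hm := (Finset.mem_filter.1 hm).2
        sum_matrixLaw_real_nonTreeDependency_le_of_small hd hd1 hm.1 hm.2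
    _ ≤ ∑ m ∈ Finset.range (Fintype.card ι), smallRatio d ^ (m + 1) :=
        Finset.sum_le_sum_of_subset_of_nonneg (Finset.filter_subset _ _) fun _ _ _ => by positivity
    _ ≤ 2 * smallRatio d := sum_range_pow_succ_le_two_mul hratio0 hratio _

lemma matrixLaw_real_exists_moderate_le {d : ℝ} (hd : Fintype.card ι * (p : ℝ) = d)
    (hd0 : 0 < d) (hp : (p : ℝ) ≤ 1 / 2) {M c : ℝ} (hM : 0 ≤ M) (hc : Real.exp (-(2 * M)) / 2 = c) :
    (matrixLaw ι ι p).real {f | ∃ S, (1 / 2 ≤ S.card * (p : ℝ) ∧ S.card * (p : ℝ) ≤ M) ∧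
      f ∈ nonTreeDependency ι S} ≤
      ((1 - c / 2) * (c / 2) ^ (-(M / d))) ^ Fintype.card ι := by
  classical
  have hdpos : 0 < Fintype.card ι * (p : ℝ) := hd.symm ▸ hd0
  have hp0 : 0 < (p : ℝ) := pos_of_mul_pos_right hdpos (Nat.cast_nonneg _)
  have hcard : (Fintype.card ι : ℝ) ≠ 0 := left_ne_zero_of_mul hdpos.ne'
  have hc0 : 0 < c := hc ▸ by positivity
  have hc1 : c ≤ 1 := by
    have : Real.exp (-(2 * M)) ≤ 1 := Real.exp_le_one_iff.2 (by linarith)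
    linarith
  have hrpow : (c / 2) ^ (-(M / p)) =
      ((c / 2) ^ (-(M / d))) ^ Fintype.card ι := by
    rw [← Real.rpow_mul_natCast (by positivity), ← hd]
    congr 1
    field_simp
  calc _ ≤ ∑ S : Finset ι with 1 / 2 ≤ S.card * (p : ℝ) ∧ S.card * (p : ℝ) ≤ M,
        (matrixLaw ι ι p).real (nonTreeDependency ι S) :=
        matrixLaw_real_exists_nonTreeDependency_le _
    _ ≤ ∑ S : Finset ι with 1 / 2 ≤ S.card * (p : ℝ) ∧ S.card * (p : ℝ) ≤ M,
        (1 - c) ^ Fintype.card ι := Finset.sum_le_sum fun S hS =>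
          have hS := (Finset.mem_filter.1 hS).2
          hc ▸ matrixLaw_real_nonTreeDependency_le_of_moderate hp hS.1 hS.2
    _ ≤ ∑ S : Finset ι with (S.card : ℝ) ≤ M / p, (1 - c) ^ Fintype.card ι := by
        refine Finset.sum_le_sum_of_subset_of_nonneg ?_ fun _ _ _ => pow_nonneg (by linarith) _
        exact Finset.monotone_filter_right _ fun _ _ hS => (le_div_iff₀ hp0).2 hS.2
    _ ≤ (1 - c / 2) ^ Fintype.card ι * (c / 2) ^ (-(M / p)) := by
        rw [Finset.sum_const, nsmul_eq_mul]
        exact card_card_le_mul_one_sub_pow_le hc0 hc1 _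
    _ = _ := by rw [hrpow, mul_pow]

lemma matrixLaw_real_exists_large_le (hp : (p : ℝ) ≤ 1 / 2) :
    (matrixLaw ι ι p).real {f | ∃ S, (8192 ≤ S.card * (p : ℝ) ∧ 2 * S.card ≤ Fintype.card ι) ∧
      f ∈ nonTreeDependency ι S} ≤ (1 / 2) ^ Fintype.card ι := by
  classical
  calc _ ≤ ∑ S : Finset ι with 8192 ≤ S.card * (p : ℝ) ∧ 2 * S.card ≤ Fintype.card ι,
        (matrixLaw ι ι p).real (nonTreeDependency ι S) :=
        matrixLaw_real_exists_nonTreeDependency_le _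
    _ ≤ ∑ S : Finset ι with 8192 ≤ S.card * (p : ℝ) ∧ 2 * S.card ≤ Fintype.card ι,
        (1 / 4) ^ Fintype.card ι := Finset.sum_le_sum fun S hS =>
          have hS := (Finset.mem_filter.1 hS).2
          matrixLaw_real_nonTreeDependency_le_of_large hp hS.1 hS.2
    _ ≤ ∑ _S : Finset ι, (1 / 4) ^ Fintype.card ι :=
        Finset.sum_le_sum_of_subset_of_nonneg (Finset.filter_subset _ _) fun _ _ _ => by positivity
    _ = (1 / 2) ^ Fintype.card ι := by
        rw [Finset.sum_const, Finset.card_univ, Fintype.card_finset, nsmul_eq_mul, Nat.cast_pow,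
          ← mul_pow]
        norm_num

end UnionBounds

section Asymptotics

lemma tendsto_smallRatio_atTop_nhds_zero : Tendsto smallRatio atTop (𝓝 0) := by
  have h := ((Real.tendsto_pow_mul_exp_neg_atTop_nhds_zero 2).comp
    (tendsto_id.atTop_div_const (show (0 : ℝ) < 4 by norm_num))).const_mul
      (2 * (4 * Real.exp 1) ^ 2)
  rw [mul_zero] at h
  refine h.congr fun d => ?_
  simp only [Function.comp_apply, id_eq, smallRatio]
  ring

lemma tendsto_pow_self_atTop_nhds_zero {u : ℕ → ℝ} {a : ℝ} (hu0 : ∀ n, 0 ≤ u n)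
    (hu : Tendsto u atTop (𝓝 a)) (ha : a < 1) : Tendsto (fun n => u n ^ n) atTop (𝓝 0) := by
  obtain ⟨r, har, hr1⟩ := exists_between ha
  have hr0 : 0 ≤ r := (ge_of_tendsto' hu hu0).trans har.le
  refine squeeze_zero' (.of_forall fun n => pow_nonneg (hu0 n) n) ?_
    (tendsto_pow_atTop_nhds_zero_of_lt_one hr0 hr1)
  filter_upwards [hu.eventually_le_const har] with n hn
  exact pow_le_pow_left₀ (hu0 n) hn n

/-- The event that some set of at most half of the columns forms a minimal dependency that is not
a tree dependency. -/
def halfNonTreeDependency (ι : Type*) [Fintype ι] : Set (ι → ι → Bool) :=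
  {f | ∃ S : Finset ι, 2 * S.card ≤ Fintype.card ι ∧ f ∈ nonTreeDependency ι S}

lemma matrixLaw_real_halfNonTreeDependency_le {ι : Type*} [Fintype ι] {p : unitInterval}
    {d : ℝ} (hd : Fintype.card ι * (p : ℝ) = d) (hd1 : 1 ≤ d)
    (hratio : smallRatio d ≤ 1 / 2) (hp : (p : ℝ) ≤ 1 / 2) {c : ℝ}
    (hc : Real.exp (-(2 * 8192)) / 2 = c) :
    (matrixLaw ι ι p).real (halfNonTreeDependency ι) ≤ 2 * smallRatio d +
      ((1 - c / 2) * (c / 2) ^ (-(8192 / d))) ^ Fintype.card ι +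
      (1 / 2) ^ Fintype.card ι := by
  refine (measureReal_mono ?_ (measure_ne_top _ _)).trans <| (measureReal_union_le _ _).trans <|
    add_le_add ((measureReal_union_le _ _).trans <|
      add_le_add (matrixLaw_real_exists_small_le hd hd1 hratio)
        (matrixLaw_real_exists_moderate_le hd (by linarith) hp (by norm_num) hc))
      (matrixLaw_real_exists_large_le hp)
  rintro f ⟨S, hS, hf⟩
  rcases le_total (S.card * (p : ℝ)) (1 / 2) with hsmall | hsmall
  · exact .inl (.inl ⟨S, ⟨hsmall, hS⟩, hf⟩)
  rcases le_total (S.card * (p : ℝ)) 8192 with hlarge | hlarge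
  · exact .inl (.inr ⟨S, ⟨hsmall, hlarge⟩, hf⟩)
  · exact .inr ⟨S, ⟨hlarge, hS⟩, hf⟩

lemma tendsto_matrixLaw_real_halfNonTreeDependency {p : ℕ → unitInterval}
    (hp : Tendsto (fun n : ℕ => (n : ℝ) * (p n : ℝ)) atTop atTop)
    (hp_half : ∀ n, (p n : ℝ) ≤ 1 / 2) :
    Tendsto (fun n => (matrixLaw (Fin n) (Fin n) (p n)).real (halfNonTreeDependency (Fin n)))
      atTop (𝓝 0) := by
  obtain ⟨c, hc⟩ : ∃ c, Real.exp (-(2 * 8192)) / 2 = c := ⟨_, rfl⟩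
  have hc0 : 0 < c := hc ▸ by positivity
  have hc1 : c ≤ 1 := by
    rw [← hc]
    exact (half_le_self (Real.exp_pos _).le).trans (Real.exp_le_one_iff.2 (by norm_num))
  have hsmall : Tendsto (fun n : ℕ => smallRatio (n * (p n : ℝ))) atTop (𝓝 0) :=
    tendsto_smallRatio_atTop_nhds_zero.comp hp
  have hmoderate : Tendsto (fun n : ℕ =>
      ((1 - c / 2) * (c / 2) ^ (-(8192 / (n * (p n : ℝ))))) ^ n) atTop (𝓝 0) := by
    have hexponent : Tendsto (fun n : ℕ => -(8192 / (n * (p n : ℝ)))) atTop (𝓝 0) := by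
      simpa only [neg_zero] using (hp.const_div_atTop (8192 : ℝ)).neg
    have hbase := ((Real.continuousAt_const_rpow (by positivity : c / 2 ≠ 0)).tendsto.comp
      hexponent).const_mul (1 - c / 2)
    rw [Real.rpow_zero, mul_one] at hbase
    exact tendsto_pow_self_atTop_nhds_zero
      (fun n => mul_nonneg (by linarith) (by positivity)) hbase (by linarith)
  have hlarge : Tendsto (fun n : ℕ => (1 / 2 : ℝ) ^ n) atTop (𝓝 0) :=
    tendsto_pow_atTop_nhds_zero_of_lt_one (by norm_num) (by norm_num)
  refine squeeze_zero' (.of_forall fun n => measureReal_nonneg) ?_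
    (by simpa only [mul_zero, add_zero] using ((hsmall.const_mul 2).add hmoderate).add hlarge)
  filter_upwards [hp.eventually_ge_atTop 1,
    hsmall.eventually_le_const (show (0 : ℝ) < 1 / 2 by norm_num)] with n hd hratio
  simpa only [Fintype.card_fin] using
    matrixLaw_real_halfNonTreeDependency_le (ι := Fin n) (by rw [Fintype.card_fin]) hd hratio
      (hp_half n) hc

variable {n : ℕ} {p : unitInterval}

lemma mem_halfNonTreeDependency_or_exists_majoritySupport {f : Fin n → Fin n → Bool}
    (hf : ¬ MinimalDependenciesAreTrees (rowMatrix f)) :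
    f ∈ halfNonTreeDependency (Fin n) ∨
      ∃ z ∈ majoritySupport (Fin n), (rowMatrix f).mulVec z = 0 := by
  simp only [MinimalDependenciesAreTrees, not_forall] at hf
  obtain ⟨_, S, rfl, hdep, htree⟩ := hf
  refine (le_or_gt (2 * S.card) (Fintype.card (Fin n))).imp
    (fun hS => ⟨S, hS, hdep, htree⟩) fun hS => ?_
  obtain ⟨z, hz, hfz⟩ := hdep.exists_mulVec_eq_zero
  have hsupp : ({j | z j ≠ 0} : Finset (Fin n)) = S := by
    ext j
    rw [Finset.mem_filter_univ, hz]
  exact ⟨z, by rwa [majoritySupport, Set.mem_ofPred_eq, hsupp], hfz⟩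

instance (n : ℕ) (p : unitInterval) : IsProbabilityMeasure (bernoulliLaw n p) :=
  inferInstanceAs (IsProbabilityMeasure (Measure.pi _))

lemma bernoulliLaw_real_not_minimalDependenciesAreTrees_le (hp0 : 0 < (p : ℝ))
    (hp : (p : ℝ) ≤ 1 / 2) :
    (bernoulliLaw n p).real {b | ¬ (MinimalDependenciesAreTrees (zeroOneMatrix b) ∨
      MinimalDependenciesAreTrees (zeroOneMatrix b).transpose)} ≤
      2 * (matrixLaw (Fin n) (Fin n) p).real (halfNonTreeDependency (Fin n)) +
        2 * (√(n * p / 4))⁻¹ := by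
  let half : Set (Fin n → Fin n → Bool) := halfNonTreeDependency (Fin n)
  let kernels : Set (Fin n → Fin n → Bool) :=
    {f | (∃ z ∈ majoritySupport (Fin n), (rowMatrix f).mulVec z = 0) ∧
      ∃ w ∈ majoritySupport (Fin n), (rowMatrix f).transpose.mulVec w = 0}
  have hsub : {b | ¬ (MinimalDependenciesAreTrees (zeroOneMatrix b) ∨
      MinimalDependenciesAreTrees (zeroOneMatrix b).transpose)} ⊆
      Function.curry ⁻¹' (half ∪ Function.swap ⁻¹' half ∪ kernels) := by
    intro b hb
    obtain ⟨hcol, hrow⟩ := not_or.1 hb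
    obtain h | hz := mem_halfNonTreeDependency_or_exists_majoritySupport hcol
    · exact .inl (.inl h)
    obtain h | hw := mem_halfNonTreeDependency_or_exists_majoritySupport hrow
    · exact .inl (.inr h)
    · exact .inr ⟨hz, hw⟩
  have hkernels : (matrixLaw (Fin n) (Fin n) p).real kernels ≤ 2 * (√(n * p / 4))⁻¹ := by
    simpa only [Fintype.card_fin] using
      matrixLaw_real_majoritySupport_kernels_le (ι := Fin n) (κ := Fin n) hp0 hp
  have hswap : (matrixLaw (Fin n) (Fin n) p).real (Function.swap ⁻¹' half) =
      (matrixLaw (Fin n) (Fin n) p).real half :=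
    measurePreserving_swap.measureReal_preimage MeasurableSet.of_discrete.nullMeasurableSet
  calc _ ≤ (bernoulliLaw n p).real
        (Function.curry ⁻¹' (half ∪ Function.swap ⁻¹' half ∪ kernels)) :=
        measureReal_mono hsub (measure_ne_top _ _)
    _ = (matrixLaw (Fin n) (Fin n) p).real (half ∪ Function.swap ⁻¹' half ∪ kernels) :=
        (measurePreserving_curry n p).measureReal_preimage
          MeasurableSet.of_discrete.nullMeasurableSet
    _ ≤ (matrixLaw (Fin n) (Fin n) p).real half +
          (matrixLaw (Fin n) (Fin n) p).real (Function.swap ⁻¹' half) +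
          (matrixLaw (Fin n) (Fin n) p).real kernels :=
        (measureReal_union_le _ _).trans (add_le_add_left (measureReal_union_le _ _) _)
    _ ≤ _ := by
        rw [hswap, two_mul]
        gcongr

lemma tendsto_bernoulliLaw_real_not_minimalDependenciesAreTrees {p : ℕ → unitInterval}
    (hp : Tendsto (fun n : ℕ => (n : ℝ) * (p n : ℝ)) atTop atTop)
    (hp_half : ∀ n, (p n : ℝ) ≤ 1 / 2) :
    Tendsto (fun n => (bernoulliLaw n (p n)).real
      {b | ¬ (MinimalDependenciesAreTrees (zeroOneMatrix b) ∨
        MinimalDependenciesAreTrees (zeroOneMatrix b).transpose)}) atTop (𝓝 0) := by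
  have hkernels : Tendsto (fun n : ℕ => (√(n * (p n : ℝ) / 4))⁻¹) atTop (𝓝 0) :=
    tendsto_inv_atTop_zero.comp <| Real.tendsto_sqrt_atTop.comp <|
      hp.atTop_div_const (by norm_num)
  have hhalf := tendsto_matrixLaw_real_halfNonTreeDependency hp hp_half
  refine squeeze_zero' (.of_forall fun n => measureReal_nonneg) ?_
    (by simpa only [mul_zero, add_zero] using (hhalf.const_mul 2).add (hkernels.const_mul 2))
  filter_upwards [hp.eventually_gt_atTop 0] with n hn
  exact bernoulliLaw_real_not_minimalDependenciesAreTrees_le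
    (pos_of_mul_pos_right hn (Nat.cast_nonneg n)) (hp_half n)

end Asymptotics

end

end SparseRank

theorem theorem4 (p : ℕ → unitInterval)
    (hp : Tendsto (fun n : ℕ => (n : ℝ) * (p n : ℝ)) atTop atTop)
    (hp_half : ∀ n, (p n : ℝ) ≤ 1 / 2) :
    Tendsto
      (fun n : ℕ => (SparseRank.bernoulliLaw n (p n)).real
        {b | SparseRank.MinimalDependenciesAreTrees (SparseRank.zeroOneMatrix b) ∨
          SparseRank.MinimalDependenciesAreTrees (SparseRank.zeroOneMatrix b).transpose})
      atTop (𝓝 1) := by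
  have hfail := SparseRank.tendsto_bernoulliLaw_real_not_minimalDependenciesAreTrees hp hp_half
  refine (sub_zero (1 : ℝ) ▸ hfail.const_sub 1).congr fun n => ?_
  rw [← probReal_compl_eq_one_sub .of_discrete]
  simp only [Set.compl_ofPred, not_not]
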